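/- Let $n\ge 1$. For $f\in\mathscr S(\mathbb R^n)$ put $\widehat f(\xi)=\int_{\mathbb R^n} f(x)e^{-ix\cdot\xi}\,dx$. Definitions. An amplitude $\sigma\in S^m$ ($m\in\mathbb R$) is a function $\sigma\in C^\infty(\mathbb R^n\times\mathbb R^n)$ such that for all multi-indices $\alpha,\beta$ there is a constant $C_{\alpha,\beta}$ with $|\partial_\xi^\alpha\partial_x^\beta\sigma(x,\xi)|\le C_{\alpha,\beta}(1+|\xi|^2)^{(m-|\alpha|)/2}$ for all $x,\xi$. A phase function is a function $\varphi:\mathbb R^n\to\mathbb R$, smooth on $\mathbb R^n\setminus\{0\}$, with $\varphi(t\xi)=t\varphi(\xi)$ for all $t>0$. For such $\sigma,\varphi$ and $f\in\mathscr S(\mathbb R^n)$ let $$T_\sigma^\varphi f(x)=(2\pi)^{-n}\int_{\mathbb R^n}\sigma(x,\xi)\,e^{ix\cdot\xi+i\varphi(\xi)}\,\widehat f(\xi)\,d\xi ,$$ which is a bounded function and so a tempered distribution, and put $T=T_1^{|\cdot|}$, i.e. $Tf(x)=(2\pi)^{-n}\int\widehat f(\xi)e^{ix\cdot\xi+i|\xi|}\,d\xi$.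 Let $\psi_0\in C_c^\infty(\mathbb R^n)$ be equal to $1$ on $B(0,1)$ and vanish off $B(0,2)$. For $p>0$ the local Hardy space $h^p(\mathbb R^n)$ consists of the tempered distributions $u$ with $$\|u\|_{h^p}=\Big(\int_{\mathbb R^n}\sup_{0<t<1}|\psi_0(tD)u(x)|^p\,dx\Big)^{1/p}<\infty ,$$ where $\psi_0(tD)u(x)=\langle u,K_t(x-\cdot)\rangle$ and $K_t(z)=(2\pi)^{-n}\int\psi_0(t\xi)e^{iz\cdot\xi}\,d\xi$. Let $\mathcal A$ be the set of all radial $f\in\mathscr S(\mathbb R^n)$ such that $\widehat f$ has compact support and equals $1$ in a neighbourhood of the origin. Theorem. (a) $\mathcal A\neq\emptyset$. (b) For every $f\in\mathcal A$, $$Tf(x)=\frac{\Gamma(\frac{n+1}{2})\,\widehat f(0)}{\pi^{(n+1)/2}\,i}\,|x|^{-(n+1)}+O\Big(\frac{1+\log|x|}{|x|^{n+3}}\Big)\qquad\text{as }|x|\to\infty .$$ (c) For every $f\in\mathcal A$, every $0<p\le\frac n{n+1}$ and every choice of $\psi_0$: $\;Tf\notin L^p(\mathbb R^n)$, while $f\in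 h^p(\mathbb R^n)$ and $Tf\notin h^p(\mathbb R^n)$. (d) Consequently global $h^p$-boundedness of Fourier integral operators fails for $0<p\le\frac n{n+1}$, whatever the order of the amplitude: there is an amplitude $\sigma\in\bigcap_{m\in\mathbb R}S^m$ such that for every $0<p\le\frac n{n+1}$ and every choice of $\psi_0$ there is no finite constant $C$ with $\|T_\sigma^{|\cdot|}f\|_{h^p}\le C\|f\|_{h^p}$ for all $f\in\mathscr S(\mathbb R^n)$. In particular the lower bound $p>\frac n{n+1}$ on the exponent cannot be relaxed in a theorem asserting that all $T_\sigma^\varphi$ with $\sigma\in S^m$, $m=-(n-1)|\frac1p-\frac12|$, and $\varphi$ a phase function are bounded on $h^p(\mathbb R^n)$. -/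

import Mathlib

open MeasureTheory Filter Topology Set
open scoped SchwartzMap ContDiff FourierTransform ENNReal NNReal

namespace GlobalFIO

/-- Euclidean space `ℝⁿ`. -/
abbrev Rn (n : ℕ) := EuclideanSpace ℝ (Fin n)

/-- The Fourier transform `f̂(ξ) = ∫ f(x) e^{-i x·ξ} dx`. -/
noncomputable def hat {n : ℕ} (f : Rn n → ℂ) (ξ : Rn n) : ℂ :=
  ∫ x : Rn n, f x * Complex.exp (-(Complex.I * ((inner ℝ x ξ : ℝ) : ℂ)))

/-- The linear Fourier integral operator with amplitude `σ` and phase `φ`,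
`T f(x) = (2π)^{-n} ∫ σ(x,ξ) e^{i x·ξ + i φ(ξ)} f̂(ξ) dξ`. -/
noncomputable def fio {n : ℕ} (σ : Rn n → Rn n → ℂ) (φ : Rn n → ℝ) (f : Rn n → ℂ)
    (x : Rn n) : ℂ :=
  (((2 * Real.pi) ^ n : ℝ) : ℂ)⁻¹ *
    ∫ ξ : Rn n, σ x ξ * Complex.exp (Complex.I * ((inner ℝ x ξ + φ ξ : ℝ) : ℂ)) * hat f ξ

/-- The class `S^m` of amplitudes: `σ` is smooth on `ℝⁿ × ℝⁿ`, and all derivatives of order `k` in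
`ξ` and `l` in `x` are bounded by a constant times `⟨ξ⟩^{m-k}`, `⟨ξ⟩ = (1 + |ξ|²)^{1/2}`. -/
structure IsAmplitude {n : ℕ} (m : ℝ) (σ : Rn n → Rn n → ℂ) : Prop where
  smooth : ContDiff ℝ ∞ (fun z : Rn n × Rn n => σ z.1 z.2)
  bound : ∀ k l : ℕ, ∃ C : ℝ, ∀ x ξ : Rn n,
    ‖iteratedFDeriv ℝ k (fun η => iteratedFDeriv ℝ l (fun y => σ y η) x) ξ‖
      ≤ C * (1 + ‖ξ‖ ^ 2) ^ ((m - k) / 2)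

/-- Phase functions: smooth away from the origin, positively homogeneous of degree one. -/
structure IsPhase {n : ℕ} (φ : Rn n → ℝ) : Prop where
  smooth : ContDiffOn ℝ ∞ φ {0}ᶜ
  homogeneous : ∀ (ξ : Rn n) (t : ℝ), 0 < t → φ (t • ξ) = t * φ ξ

/-- The constant function `1` is an amplitude of order `0`. -/
theorem isAmplitude_one (n : ℕ) : IsAmplitude 0 (fun _ _ : Rn n => (1 : ℂ)) where
  smooth := contDiff_const
  bound := by
    intro k l
    refine ⟨1, fun x ξ => ?_⟩
    rcases Nat.eq_zero_or_pos k with rfl | hk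
    · rcases Nat.eq_zero_or_pos l with rfl | hl
      · simp
      · simp [iteratedFDeriv_const_of_ne hl.ne']
    · rw [iteratedFDeriv_const_of_ne hk.ne']
      simp only [Pi.zero_apply, norm_zero]
      positivity

/-- `ξ ↦ |ξ|` is a phase function. -/
theorem isPhase_norm (n : ℕ) : IsPhase (fun ξ : Rn n => ‖ξ‖) where
  smooth := fun ξ hξ => (contDiffAt_norm ℝ hξ).contDiffWithinAt
  homogeneous := fun ξ t ht => by rw [norm_smul, Real.norm_of_nonneg ht.le]

theorem hat_eq {n : ℕ} (f : 𝓢(Rn n, ℂ)) (ξ : Rn n) :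
    hat f ξ = (𝓕 f : 𝓢(Rn n, ℂ)) ((2 * Real.pi)⁻¹ • ξ) := by
  rw [SchwartzMap.fourier_coe, Real.fourier_eq']
  unfold hat
  congr 1
  ext x
  rw [smul_eq_mul, mul_comm, inner_smul_right]
  congr 2
  push_cast
  have : (Real.pi : ℂ) ≠ 0 := by exact_mod_cast Real.pi_ne_zero
  field_simp

theorem hat_integrable {n : ℕ} (f : 𝓢(Rn n, ℂ)) (k : ℕ) :
    Integrable (fun ξ : Rn n => ‖ξ‖ ^ k * ‖hat f ξ‖) := by
  have h := (SchwartzMap.integrable_pow_mul volume (𝓕 f : 𝓢(Rn n, ℂ)) k).comp_smul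
    (R := (2 * Real.pi)⁻¹) (by positivity)
  refine (h.const_mul ((2 * Real.pi) ^ k)).congr (Eventually.of_forall fun ξ => ?_)
  simp only [hat_eq, norm_smul, norm_inv, Real.norm_of_nonneg (by positivity : 0 ≤ 2 * Real.pi)]
  rw [← mul_assoc, ← mul_pow, mul_inv_cancel_left₀ (by positivity)]

/-- For Schwartz `f` the function `T f` is bounded (and measurable). -/
theorem fio_memLp_top {n : ℕ} {m : ℝ} {σ : Rn n → Rn n → ℂ} {φ : Rn n → ℝ}
    (hσ : IsAmplitude m σ) (hφ : IsPhase φ) (f : 𝓢(Rn n, ℂ)) :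
    MemLp (fio σ φ f) ∞ volume := by
  have hφm : Measurable φ := by
    refine measurable_of_continuousOn_compl_singleton 0 hφ.smooth.continuousOn
  have hhat : Measurable (hat (f : Rn n → ℂ)) := by
    have : hat (f : Rn n → ℂ) = fun ξ => (𝓕 f : 𝓢(Rn n, ℂ)) ((2 * Real.pi)⁻¹ • ξ) :=
      funext (hat_eq f)
    rw [this]
    exact ((SchwartzMap.continuous _).comp (continuous_const_smul _)).measurable
  have hmeas : StronglyMeasurable (fio σ φ f) := by
    unfold fio
    refine StronglyMeasurable.const_mul (StronglyMeasurable.integral_prod_right (ν := volume)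
      (f := fun (x : Rn n) (ξ : Rn n) => σ x ξ *
        Complex.exp (Complex.I * ((inner ℝ x ξ + φ ξ : ℝ) : ℂ)) * hat f ξ) ?_) _
    refine Measurable.stronglyMeasurable ?_
    refine (hσ.smooth.continuous.measurable.mul ?_).mul (hhat.comp measurable_snd)
    refine Complex.measurable_exp.comp (measurable_const.mul (Complex.measurable_ofReal.comp ?_))
    exact (continuous_fst.inner continuous_snd).measurable.add (hφm.comp measurable_snd)
  obtain ⟨C, hC⟩ := hσ.bound 0 0
  have hbd : ∀ x ξ : Rn n, ‖σ x ξ‖ ≤ |C| * (1 + ‖ξ‖ ^ 2) ^ ⌈|m|⌉₊ := by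
    intro x ξ
    have h1 : (1 : ℝ) ≤ 1 + ‖ξ‖ ^ 2 := by nlinarith [norm_nonneg ξ]
    have h0 := hC x ξ
    rw [norm_iteratedFDeriv_zero, norm_iteratedFDeriv_zero] at h0
    refine h0.trans (mul_le_mul (le_abs_self C) ?_ (by positivity) (abs_nonneg C))
    rw [← Real.rpow_natCast (1 + ‖ξ‖ ^ 2) ⌈|m|⌉₊]
    refine Real.rpow_le_rpow_of_exponent_le h1 ?_
    have h2 := Nat.le_ceil |m|
    have h3 := le_abs_self m
    have h4 := abs_nonneg m
    push_cast
    linarith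
  set N := ⌈|m|⌉₊
  have hint : Integrable (fun ξ : Rn n => |C| * (1 + ‖ξ‖ ^ 2) ^ N * ‖hat f ξ‖) := by
    have : (fun ξ : Rn n => |C| * (1 + ‖ξ‖ ^ 2) ^ N * ‖hat f ξ‖) =
        fun ξ => ∑ j ∈ Finset.range (N + 1),
          |C| * (N.choose j : ℝ) * (‖ξ‖ ^ (2 * (N - j)) * ‖hat f ξ‖) := by
      ext ξ
      rw [add_pow, Finset.mul_sum, Finset.sum_mul]
      refine Finset.sum_congr rfl fun j _ => ?_
      rw [one_pow, ← pow_mul]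
      ring
    rw [this]
    exact integrable_finsetSum _ fun j _ => (hat_integrable f _).const_mul _
  refine memLp_top_of_bound hmeas.aestronglyMeasurable
    (‖(((2 * Real.pi) ^ n : ℝ) : ℂ)⁻¹‖ *
      ∫ ξ : Rn n, |C| * (1 + ‖ξ‖ ^ 2) ^ N * ‖hat f ξ‖) (Eventually.of_forall fun x => ?_)
  unfold fio
  rw [norm_mul]
  refine mul_le_mul_of_nonneg_left ?_ (norm_nonneg _)
  refine norm_integral_le_of_norm_le hint (Eventually.of_forall fun ξ => ?_)
  rw [norm_mul, norm_mul, mul_comm Complex.I, Complex.norm_exp_ofReal_mul_I, mul_one]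
  exact mul_le_mul_of_nonneg_right (hbd x ξ) (norm_nonneg _)

/-- `T f`, for a Schwartz function `f`, as a tempered distribution: `g ↦ ∫ T f(x) g(x) dx`. -/
noncomputable def fioDist {n : ℕ} {m : ℝ} {σ : Rn n → Rn n → ℂ} {φ : Rn n → ℝ}
    (hσ : IsAmplitude m σ) (hφ : IsPhase φ) (f : 𝓢(Rn n, ℂ)) : 𝓢'(Rn n, ℂ) :=
  Lp.toTemperedDistribution ((fio_memLp_top hσ hφ f).toLp (fio σ φ f))

/-- The generating cut-off `ψ₀` of a Littlewood-Paley decomposition: smooth, equal to `1` on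
`B(0,1)` and vanishing off `B(0,2)`. -/
structure LPCutoff (n : ℕ) where
  toFun : Rn n → ℂ
  smooth : ContDiff ℝ ∞ toFun
  eq_one : ∀ ξ ∈ Metric.ball (0 : Rn n) 1, toFun ξ = 1
  support_subset : Function.support toFun ⊆ Metric.ball (0 : Rn n) 2

/-- `w ↦ ψ₀(2πtw) e^{2πi x·w}`, a smooth function of compact support. -/
noncomputable def LPCutoff.modulated {n : ℕ} (ψ : LPCutoff n) (t : ℝ) (x w : Rn n) : ℂ :=
  ψ.toFun ((2 * Real.pi * t) • w) *
    Complex.exp (((2 * Real.pi * inner ℝ x w : ℝ) : ℂ) * Complex.I)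

theorem LPCutoff.modulated_hasCompactSupport {n : ℕ} (ψ : LPCutoff n) {t : ℝ} (ht : 0 < t)
    (x : Rn n) : HasCompactSupport (ψ.modulated t x) := by
  have h : HasCompactSupport ψ.toFun :=
    HasCompactSupport.of_support_subset_isCompact (isCompact_closedBall 0 2)
      (ψ.support_subset.trans Metric.ball_subset_closedBall)
  exact (h.comp_smul (by positivity : 2 * Real.pi * t ≠ 0)).mul_right

theorem LPCutoff.modulated_contDiff {n : ℕ} (ψ : LPCutoff n) (t : ℝ) (x : Rn n) :
    ContDiff ℝ ∞ (ψ.modulated t x) := by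
  refine (ψ.smooth.comp (contDiff_const_smul _)).mul
    (Complex.contDiff_exp.comp (ContDiff.mul (Complex.ofRealCLM.contDiff.comp ?_) contDiff_const))
  exact contDiff_const.mul (contDiff_const.inner ℝ contDiff_id)

/-- The Schwartz function `y ↦ K_t(x - y)`, where `K_t(z) = (2π)^{-n} ∫ ψ₀(tξ) e^{i z·ξ} dξ` is
the convolution kernel of `ψ₀(tD)`; see `LPCutoff.kernel_apply`. -/
noncomputable def LPCutoff.kernel {n : ℕ} (ψ : LPCutoff n) (t : Ioo (0 : ℝ) 1) (x : Rn n) :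
    𝓢(Rn n, ℂ) :=
  𝓕 ((ψ.modulated_hasCompactSupport t.2.1 x).toSchwartzMap (ψ.modulated_contDiff t x))

theorem LPCutoff.kernel_apply {n : ℕ} (ψ : LPCutoff n) (t : Ioo (0 : ℝ) 1) (x y : Rn n) :
    ψ.kernel t x y = (((2 * Real.pi) ^ n : ℝ) : ℂ)⁻¹ * ∫ ξ : Rn n, ψ.toFun ((t : ℝ) • ξ) *
      Complex.exp (Complex.I * ((inner ℝ (x - y) ξ : ℝ) : ℂ)) := by
  have h := Measure.integral_comp_smul (volume : Measure (Rn n))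
    (fun ξ : Rn n => ψ.toFun ((t : ℝ) • ξ) *
      Complex.exp (Complex.I * ((inner ℝ (x - y) ξ : ℝ) : ℂ))) (2 * Real.pi)
  rw [finrank_euclideanSpace_fin, abs_of_nonneg (by positivity), Complex.real_smul,
    Complex.ofReal_inv] at h
  rw [← h, LPCutoff.kernel, SchwartzMap.fourier_coe, Real.fourier_eq']
  congr 1
  ext w
  simp only [HasCompactSupport.toSchwartzMap_toFun, LPCutoff.modulated, smul_eq_mul, smul_smul]
  rw [mul_left_comm, ← Complex.exp_add, inner_smul_right, inner_sub_left, real_inner_comm y w,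
    mul_comm (t : ℝ)]
  congr 2
  push_cast
  ring

/-- `ψ₀(tD)u`, for a tempered distribution `u`, as a function: `(ψ₀(tD)u)(x) = ⟨u, K_t(x - ·)⟩`. -/
noncomputable def LPCutoff.op {n : ℕ} (ψ : LPCutoff n) (t : Ioo (0 : ℝ) 1) (u : 𝓢'(Rn n, ℂ))
    (x : Rn n) : ℂ :=
  u (ψ.kernel t x)

/-- The quasi-norm of the local Hardy space `h^p(ℝⁿ)`, with value `∞` off `h^p(ℝⁿ)`:
`‖u‖_{h^p} = (∫ sup_{0<t<1} |ψ₀(tD)u(x)|^p dx)^{1/p}`. -/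
noncomputable def hpNorm {n : ℕ} (ψ : LPCutoff n) (p : ℝ) (u : 𝓢'(Rn n, ℂ)) : ℝ≥0∞ :=
  (∫⁻ x : Rn n, ⨆ t : Ioo (0 : ℝ) 1, ‖ψ.op t u x‖ₑ ^ p) ^ (1 / p)

/-- `f` is radial, and `f̂` has compact support and equals `1` in a neighbourhood of the origin. -/
structure IsRadialBandLimited {n : ℕ} (f : 𝓢(Rn n, ℂ)) : Prop where
  radial : ∀ x y : Rn n, ‖x‖ = ‖y‖ → f x = f y
  hat_compact : HasCompactSupport (hat f)
  hat_eq_one : ∀ᶠ ξ in 𝓝 (0 : Rn n), hat f ξ = 1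

end GlobalFIO

open GlobalFIO

namespace GlobalFIO

/-! The slow decay of `Tf` comes only from the conic singularity of `e^{i|ξ|}` at the origin, and
that singularity is the one of `e^{-|ξ|}`. Both `cos|ξ|` and `sin|ξ|/|ξ|` are smooth functions of
`|ξ|²`, and `e^{-|ξ|} = cosh|ξ| - |ξ| (sinh|ξ|/|ξ|)` can be solved for `|ξ|`. Hence `e^{i|ξ|} = s(ξ)
+ c(ξ) e^{-|ξ|}` with `s`, `c` smooth and radial and `c(0) = -i` (`exp_I_norm_eq`).

As `f̂` has compact support, `s f̂` and `c f̂` are transforms of Schwartz functions `a` and `b`, so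
`Tf = a + b * P` with `P` the Poisson kernel (`fio_norm_decomposition`). Since `b` is even, only
symmetric second differences of `P` enter, and these gain two powers of decay
(`second_difference_bound`). Thus `Tf = -i f̂(0) P` up to `O(|x|^{-n-3})`, without the logarithm.

Consequently `|Tf|^p` is at least a multiple of `|x|^{-n}` near infinity when `(n+1)p ≤ n`, and is
not integrable. For small `t` the operator `ψ₀(tD)` fixes the band-limited `Tf`, so the `h^p` norm
is infinite too, while every Schwartz function lies in `h^p`. Taking `σ = f̂` gives `T_σ f = Tg`
with `ĝ = f̂²` again admissible, which defeats all orders at once. -/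

/-! ### Fourier inversion and radial symmetry; admissible functions exist. -/

theorem hat_contDiff {n : ℕ} (f : 𝓢(Rn n, ℂ)) : ContDiff ℝ ∞ (hat (f : Rn n → ℂ)) := by
  rw [show hat (f : Rn n → ℂ) = fun ξ => (𝓕 f : 𝓢(Rn n, ℂ)) ((2 * Real.pi)⁻¹ • ξ) from
    funext (hat_eq f)]
  exact ((𝓕 f : 𝓢(Rn n, ℂ)).smooth ⊤).comp (contDiff_const_smul _)

/-- Substitution `ξ = 2πw` in an integral over frequency space. -/
theorem integral_two_pi_smul {n : ℕ} (F : Rn n → ℂ) :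
    ∫ w : Rn n, F ((2 * Real.pi) • w) = (((2 * Real.pi) ^ n : ℝ) : ℂ)⁻¹ * ∫ ξ : Rn n, F ξ := by
  have h := Measure.integral_comp_smul (volume : Measure (Rn n)) F (2 * Real.pi)
  rw [finrank_euclideanSpace_fin, abs_of_nonneg (by positivity), Complex.real_smul,
    Complex.ofReal_inv] at h
  exact h

/-- Fourier inversion for `hat`. -/
theorem hat_inversion {n : ℕ} (f : 𝓢(Rn n, ℂ)) (x : Rn n) :
    f x = (((2 * Real.pi) ^ n : ℝ) : ℂ)⁻¹ *
      ∫ ξ : Rn n, Complex.exp (Complex.I * ((inner ℝ x ξ : ℝ) : ℂ)) * hat f ξ := by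
  rw [← integral_two_pi_smul]
  conv_lhs => rw [← FourierTransform.fourierInv_fourier_eq (F := 𝓢(Rn n, ℂ)) f, SchwartzMap.fourierInv_coe,
    Real.fourierInv_eq']
  congr 1
  ext w
  rw [hat_eq, smul_smul, inv_mul_cancel₀ (by positivity), one_smul, smul_eq_mul,
    inner_smul_right, real_inner_comm, mul_comm Complex.I]

/-- Every smooth compactly supported function is `f̂` for some Schwartz function `f`. -/
theorem exists_hat_eq {n : ℕ} (g : Rn n → ℂ) (hc : HasCompactSupport g) (hs : ContDiff ℝ ∞ g) :
    ∃ f : 𝓢(Rn n, ℂ), hat (f : Rn n → ℂ) = g := by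
  have hc' : HasCompactSupport (fun w : Rn n => g ((2 * Real.pi) • w)) :=
    hc.comp_smul (by positivity : 2 * Real.pi ≠ 0)
  have hs' : ContDiff ℝ ∞ (fun w : Rn n => g ((2 * Real.pi) • w)) :=
    hs.comp (contDiff_const_smul _)
  refine ⟨𝓕⁻ (hc'.toSchwartzMap hs'), funext fun ξ => ?_⟩
  rw [hat_eq, FourierTransform.fourier_fourierInv_eq]
  simp only [HasCompactSupport.toSchwartzMap_toFun, smul_smul]
  rw [mul_inv_cancel₀ (by positivity), one_smul]

theorem hat_isometry {n : ℕ} (f : Rn n → ℂ) (A : Rn n ≃ₗᵢ[ℝ] Rn n) (ξ : Rn n) :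
    hat f (A ξ) = hat (fun x => f (A x)) ξ := by
  unfold hat
  rw [← A.measurePreserving.integral_comp A.toHomeomorph.measurableEmbedding]
  simp only [LinearIsometryEquiv.inner_map_map]

/-- Vectors of equal norm are exchanged by the reflection in the hyperplane orthogonal to their
difference, so invariance under isometries suffices. -/
theorem hat_radial {n : ℕ} {f : Rn n → ℂ} (hf : ∀ x y : Rn n, ‖x‖ = ‖y‖ → f x = f y)
    (ξ η : Rn n) (h : ‖ξ‖ = ‖η‖) : hat f ξ = hat f η := by
  rw [← Submodule.reflection_sub h, hat_isometry]
  congr 1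
  ext x
  exact hf _ _ (LinearIsometryEquiv.norm_map _ x).symm

theorem radial_of_hat_radial {n : ℕ} {f : 𝓢(Rn n, ℂ)}
    (hf : ∀ ξ η : Rn n, ‖ξ‖ = ‖η‖ → hat f ξ = hat f η) (x y : Rn n) (h : ‖x‖ = ‖y‖) :
    f x = f y := by
  set A := ((ℝ ∙ (x - y))ᗮ).reflection with hA
  have hxy : A x = y := Submodule.reflection_sub h
  rw [hat_inversion f x, hat_inversion f y, ← hxy]
  congr 1
  conv_rhs => rw [← A.measurePreserving.integral_comp A.toHomeomorph.measurableEmbedding]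
  congr 1
  ext ξ
  rw [LinearIsometryEquiv.inner_map_map, hf (A ξ) ξ (A.norm_map ξ)]

/-- A smooth, radial, compactly supported function equal to `1` near the origin is `f̂` for an
admissible `f`. -/
theorem exists_isRadialBandLimited {n : ℕ} (g : Rn n → ℂ) (hc : HasCompactSupport g)
    (hs : ContDiff ℝ ∞ g) (hr : ∀ ξ η : Rn n, ‖ξ‖ = ‖η‖ → g ξ = g η)
    (h1 : ∀ᶠ ξ in 𝓝 (0 : Rn n), g ξ = 1) :
    ∃ f : 𝓢(Rn n, ℂ), IsRadialBandLimited f ∧ hat (f : Rn n → ℂ) = g := by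
  obtain ⟨f, rfl⟩ := exists_hat_eq g hc hs
  exact ⟨f, ⟨radial_of_hat_radial hr, hc, h1⟩, rfl⟩

theorem exists_radial_bump (n : ℕ) : ∃ f : 𝓢(Rn n, ℂ), IsRadialBandLimited f := by
  refine (exists_isRadialBandLimited
    -- Using `|ξ|²` rather than `|ξ|` keeps the cut-off smooth at the origin; it is `1` for `|ξ| ≤
    -- 1` and `0` for `|ξ|² ≥ 2`.
    (fun ξ : Rn n => ((Real.smoothTransition (2 - ‖ξ‖ ^ 2) : ℝ) : ℂ)) ?_ ?_ ?_ ?_).imp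
    fun f hf => hf.1
  · refine HasCompactSupport.of_support_subset_isCompact (isCompact_closedBall 0 2) fun ξ hξ => ?_
    rw [mem_closedBall_zero_iff]
    by_contra! h
    refine hξ ?_
    simp only [Complex.ofReal_eq_zero]
    exact Real.smoothTransition.zero_of_nonpos (by nlinarith)
  · exact Complex.ofRealCLM.contDiff.comp
      (Real.smoothTransition.contDiff.comp (contDiff_const.sub (contDiff_norm_sq ℝ)))
  · intro ξ η h
    simp only [h]
  · filter_upwards [Metric.ball_mem_nhds (0 : Rn n) one_pos] with ξ hξ
    rw [mem_ball_zero_iff] at hξ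
    rw [Real.smoothTransition.one_of_one_le (by nlinarith [norm_nonneg ξ]), Complex.ofReal_one]

/-! ### Subordination and the Poisson kernel. -/

/-- The antiderivative `∫₀ᶻ e^{-s²} ds` of the Gaussian. -/
noncomputable def gaussPrimitive (z : ℝ) : ℝ := ∫ s in (0 : ℝ)..z, Real.exp (-1 * s ^ 2)

theorem gaussPrimitive_hasDerivAt (z : ℝ) :
    HasDerivAt gaussPrimitive (Real.exp (-1 * z ^ 2)) z := by
  have hc : Continuous fun s : ℝ => Real.exp (-1 * s ^ 2) := by fun_prop
  exact intervalIntegral.integral_hasDerivAt_right (hc.intervalIntegrable _ _)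
    (hc.stronglyMeasurableAtFilter _ _) hc.continuousAt

theorem gaussPrimitive_tendsto_atTop :
    Tendsto gaussPrimitive atTop (𝓝 (√Real.pi / 2)) := by
  have h := intervalIntegral_tendsto_integral_Ioi (μ := volume) (0 : ℝ)
    (integrable_exp_neg_mul_sq one_pos).integrableOn (tendsto_id (α := ℝ) (x := atTop))
  rwa [integral_gaussian_Ioi, div_one] at h

theorem gaussPrimitive_neg (z : ℝ) : gaussPrimitive (-z) = -gaussPrimitive z := by
  have h := intervalIntegral.integral_comp_neg (a := 0) (b := z)
    (fun s : ℝ => Real.exp (-1 * s ^ 2))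
  simp only [neg_sq, neg_zero] at h
  rw [gaussPrimitive, gaussPrimitive, h, intervalIntegral.integral_symm]

theorem gaussPrimitive_tendsto_atBot :
    Tendsto gaussPrimitive atBot (𝓝 (-(√Real.pi / 2))) := by
  have h := (gaussPrimitive_tendsto_atTop.comp tendsto_neg_atBot_atTop).neg
  refine h.congr fun z => ?_
  simp [gaussPrimitive_neg]

/-- `∫₀^∞ e^{-v² - c²/v²} dv = (√π/2) e^{-2c}`. -/
theorem subordination {c : ℝ} (hc : 0 < c) :
    ∫ v in Ioi (0 : ℝ), Real.exp (-v ^ 2 - c ^ 2 / v ^ 2) = √Real.pi / 2 * Real.exp (-(2 * c)) := by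
  -- An explicit antiderivative: `(v ∓ c/v)² = v² + c²/v² ∓ 2c`, so both summands reproduce the
  -- integrand, with factors `1 + c/v²` and `1 - c/v²` that average to `1`.
  set H : ℝ → ℝ := fun v => (Real.exp (-(2 * c)) * gaussPrimitive (v - c / v) +
    Real.exp (2 * c) * gaussPrimitive (v + c / v)) / 2 with hH
  have hder : ∀ v ∈ Ioi (0 : ℝ), HasDerivAt H (Real.exp (-v ^ 2 - c ^ 2 / v ^ 2)) v := by
    intro v hv
    have hv0 : v ≠ 0 := (mem_Ioi.1 hv).ne'
    have hq : HasDerivAt (fun v : ℝ => c / v) (-c / v ^ 2) v := by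
      simpa [div_eq_mul_inv] using (hasDerivAt_inv hv0).const_mul c
    have h1 := (gaussPrimitive_hasDerivAt (v - c / v)).comp v ((hasDerivAt_id v).sub hq)
    have h2 := (gaussPrimitive_hasDerivAt (v + c / v)).comp v ((hasDerivAt_id v).add hq)
    have h3 := ((h1.const_mul (Real.exp (-(2 * c)))).add
      (h2.const_mul (Real.exp (2 * c)))).div_const 2
    refine h3.congr_deriv ?_
    have e1 : Real.exp (-(2 * c)) * Real.exp (-1 * (v - c / v) ^ 2) =
        Real.exp (-v ^ 2 - c ^ 2 / v ^ 2) := by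
      rw [← Real.exp_add]
      congr 1
      field_simp
      ring
    have e2 : Real.exp (2 * c) * Real.exp (-1 * (v + c / v) ^ 2) =
        Real.exp (-v ^ 2 - c ^ 2 / v ^ 2) := by
      rw [← Real.exp_add]
      congr 1
      field_simp
      ring
    rw [← mul_assoc, ← mul_assoc, e1, e2]
    ring
  have hinv0 : Tendsto (fun v : ℝ => c / v) (𝓝[>] 0) atTop :=
    (tendsto_inv_nhdsGT_zero.const_mul_atTop hc).congr fun v => (div_eq_mul_inv _ _).symm
  have hid0 : Tendsto (fun v : ℝ => v) (𝓝[>] 0) (𝓝 0) := tendsto_id.mono_left nhdsWithin_le_nhds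
  have hzero : Tendsto H (𝓝[>] 0) (𝓝 ((Real.exp (-(2 * c)) * -(√Real.pi / 2) +
      Real.exp (2 * c) * (√Real.pi / 2)) / 2)) := by
    refine (Tendsto.add (Tendsto.const_mul _ ?_) (Tendsto.const_mul _ ?_)).div_const 2
    · refine gaussPrimitive_tendsto_atBot.comp ?_
      simpa [sub_eq_add_neg] using hid0.add_atBot (tendsto_neg_atTop_atBot.comp hinv0)
    · exact gaussPrimitive_tendsto_atTop.comp (hid0.add_atTop hinv0)
  have hinvT : Tendsto (fun v : ℝ => c / v) atTop (𝓝 0) := tendsto_const_nhds.div_atTop tendsto_id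
  have htop : Tendsto H atTop (𝓝 ((Real.exp (-(2 * c)) * (√Real.pi / 2) +
      Real.exp (2 * c) * (√Real.pi / 2)) / 2)) := by
    refine (Tendsto.add (Tendsto.const_mul _ ?_) (Tendsto.const_mul _ ?_)).div_const 2
    · refine gaussPrimitive_tendsto_atTop.comp ?_
      simpa [sub_eq_add_neg] using tendsto_id.atTop_add hinvT.neg
    · exact gaussPrimitive_tendsto_atTop.comp (tendsto_id.atTop_add hinvT)
  -- The value `H 0` is an artefact of `c / 0 = 0`; it is replaced by the right limit to obtain
  -- continuity at the endpoint.
  set H' := Function.update H 0 ((Real.exp (-(2 * c)) * -(√Real.pi / 2) +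
      Real.exp (2 * c) * (√Real.pi / 2)) / 2)
  have hcont : ContinuousWithinAt H' (Ici 0) 0 := by
    rw [continuousWithinAt_update_same]
    simpa using hzero
  have hne : ∀ v ∈ Ioi (0 : ℝ), H =ᶠ[𝓝 v] H' := by
    intro v hv
    filter_upwards [Ioi_mem_nhds hv] with w hw
    exact (Function.update_of_ne (mem_Ioi.1 hw).ne' _ _).symm
  have h := integral_Ioi_of_hasDerivAt_of_nonneg hcont
    (fun v hv => (hder v hv).congr_of_eventuallyEq (hne v hv).symm)
    (fun v _ => (Real.exp_pos _).le)
    (htop.congr' (by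
      filter_upwards [Ioi_mem_atTop 0] with w hw
      exact (Function.update_of_ne (mem_Ioi.1 hw).ne' _ _).symm))
  rw [h]
  simp only [H', Function.update_self]
  ring

/-- The normalising constant `Γ((n+1)/2) π^{-(n+1)/2}` of the Poisson kernel. -/
noncomputable def poissonConst (n : ℕ) : ℝ :=
  Real.Gamma (((n : ℝ) + 1) / 2) / Real.pi ^ (((n : ℝ) + 1) / 2)

/-- The Poisson kernel of `ℝⁿ` at height one. -/
noncomputable def poissonKernel {n : ℕ} (x : Rn n) : ℝ :=
  poissonConst n * (1 + ‖x‖ ^ 2) ^ (-(((n : ℝ) + 1) / 2))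

/-- The integrand of the subordination formula for the Poisson kernel. -/
noncomputable def subordinand {n : ℕ} (x ξ : Rn n) (v : ℝ) : ℂ :=
  Complex.exp (Complex.I * ((inner ℝ x ξ : ℝ) : ℂ)) *
    ((Real.exp (-v ^ 2 - (‖ξ‖ / 2) ^ 2 / v ^ 2) : ℝ) : ℂ)

theorem subordinand_eq {n : ℕ} (x ξ : Rn n) (v : ℝ) (hv : v ≠ 0) :
    subordinand x ξ v = (Real.exp (-v ^ 2) : ℂ) *
      Complex.exp (-((1 / (4 * v ^ 2) : ℝ) : ℂ) * (‖ξ‖ : ℂ) ^ 2 +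
        Complex.I * ((inner ℝ x ξ : ℝ) : ℂ)) := by
  rw [subordinand]
  push_cast
  rw [← Complex.exp_add, ← Complex.exp_add]
  congr 1
  have : (v : ℂ) ≠ 0 := by exact_mod_cast hv
  field_simp
  ring

theorem gaussian_pow_half (n : ℕ) {v : ℝ} (hv : 0 < v) :
    ((Real.pi : ℂ) / ((1 / (4 * v ^ 2) : ℝ) : ℂ)) ^ ((n : ℂ) / 2) =
      (((2 * √Real.pi * v) ^ n : ℝ) : ℂ) := by
  have h : (Real.pi : ℂ) / ((1 / (4 * v ^ 2) : ℝ) : ℂ) = (((2 * √Real.pi * v) ^ 2 : ℝ) : ℂ) := by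
    rw [← Complex.ofReal_div]
    congr 1
    rw [mul_pow, mul_pow, Real.sq_sqrt Real.pi_pos.le]
    field_simp
    norm_num
  rw [h, show ((n : ℂ) / 2) = (((n : ℝ) / 2 : ℝ) : ℂ) by push_cast; ring,
    ← Complex.ofReal_cpow (by positivity)]
  congr 1
  rw [← Real.rpow_natCast _ 2, ← Real.rpow_mul (by positivity), ← Real.rpow_natCast]
  congr 1
  push_cast
  ring

/-- For fixed `v` this is a Gaussian integral in `ξ` with parameter `b = 1/(4v²)`; its factor
`e^{-|x|²/(4b)} = e^{-|x|²v²}` merges with `e^{-v²}`. -/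
theorem subordinand_integral_freq {n : ℕ} (x : Rn n) {v : ℝ} (hv : 0 < v) :
    Integrable (fun ξ : Rn n => subordinand x ξ v) ∧
    ∫ ξ : Rn n, subordinand x ξ v =
      (((2 * √Real.pi * v) ^ n * Real.exp (-(1 + ‖x‖ ^ 2) * v ^ 2) : ℝ) : ℂ) := by
  have hb : 0 < (((1 / (4 * v ^ 2) : ℝ) : ℂ)).re := by
    rw [Complex.ofReal_re]; positivity
  have he : (fun ξ : Rn n => subordinand x ξ v) = fun ξ => (Real.exp (-v ^ 2) : ℂ) *
      Complex.exp (-((1 / (4 * v ^ 2) : ℝ) : ℂ) * (‖ξ‖ : ℂ) ^ 2 +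
        Complex.I * ((inner ℝ x ξ : ℝ) : ℂ)) := funext fun ξ => subordinand_eq x ξ v hv.ne'
  rw [he]
  refine ⟨(GaussianFourier.integrable_cexp_neg_mul_sq_norm_add hb _ _).const_mul _, ?_⟩
  rw [integral_const_mul, GaussianFourier.integral_cexp_neg_mul_sq_norm_add hb,
    finrank_euclideanSpace_fin, gaussian_pow_half n hv, mul_left_comm, Complex.ofReal_mul]
  congr 1
  rw [Complex.ofReal_exp, Complex.ofReal_exp, ← Complex.exp_add]
  congr 1
  have : (v : ℂ) ≠ 0 := by exact_mod_cast hv.ne'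
  push_cast
  rw [Complex.I_sq]
  field_simp
  ring

theorem norm_subordinand {n : ℕ} (x ξ : Rn n) (v : ℝ) :
    ((‖subordinand x ξ v‖ : ℝ) : ℂ) = subordinand 0 ξ v := by
  rw [subordinand, subordinand, norm_mul, mul_comm Complex.I, Complex.norm_exp_ofReal_mul_I,
    Complex.norm_real, Real.norm_of_nonneg (Real.exp_pos _).le]
  simp

theorem integral_norm_subordinand {n : ℕ} (x : Rn n) {v : ℝ} (hv : 0 < v) :
    ∫ ξ : Rn n, ‖subordinand x ξ v‖ = (2 * √Real.pi * v) ^ n * Real.exp (-1 * v ^ 2) := by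
  have h := (subordinand_integral_freq (0 : Rn n) hv).2
  simp only [← norm_subordinand x] at h
  rw [integral_complex_ofReal] at h
  have h' := Complex.ofReal_injective h
  simpa using h'

/-- Used twice: `b = 1` gives absolute integrability for Fubini, and `b = 1 + |x|²` produces the
Poisson kernel. -/
theorem moment_gaussian (n : ℕ) {b : ℝ} (hb : 0 < b) :
    IntegrableOn (fun v : ℝ => (2 * √Real.pi * v) ^ n * Real.exp (-b * v ^ 2)) (Ioi 0) ∧
    ∫ v in Ioi (0 : ℝ), (2 * √Real.pi * v) ^ n * Real.exp (-b * v ^ 2) =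
      (2 * √Real.pi) ^ n * (b ^ (-(((n : ℝ) + 1) / 2)) / 2 * Real.Gamma (((n : ℝ) + 1) / 2)) := by
  have he : (fun v : ℝ => (2 * √Real.pi * v) ^ n * Real.exp (-b * v ^ 2)) =
      fun v : ℝ => (2 * √Real.pi) ^ n * (v ^ (n : ℝ) * Real.exp (-b * v ^ (2 : ℝ))) := by
    ext v
    rw [mul_pow, Real.rpow_natCast, Real.rpow_two, mul_assoc]
  have hn : (-1 : ℝ) < n := by have : (0 : ℝ) ≤ n := n.cast_nonneg
                               linarith
  rw [he]
  refine ⟨(integrableOn_rpow_mul_exp_neg_mul_rpow hn two_pos hb).const_mul _, ?_⟩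
  rw [integral_const_mul, integral_rpow_mul_exp_neg_mul_rpow two_pos hn hb, neg_div]
  ring

theorem subordinand_measurable {n : ℕ} (x : Rn n) :
    Measurable (fun z : Rn n × ℝ => subordinand x z.1 z.2) := by
  unfold subordinand
  fun_prop

theorem subordinand_integrable {n : ℕ} (x : Rn n) :
    Integrable (fun z : Rn n × ℝ => subordinand x z.1 z.2)
      (volume.prod (volume.restrict (Ioi 0))) := by
  rw [integrable_prod_iff' (subordinand_measurable x).aestronglyMeasurable]
  refine ⟨?_, ?_⟩
  · filter_upwards [ae_restrict_mem measurableSet_Ioi] with v hv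
    exact (subordinand_integral_freq x hv).1
  · refine (moment_gaussian n one_pos).1.congr ?_
    filter_upwards [ae_restrict_mem measurableSet_Ioi] with v hv
    exact (integral_norm_subordinand x hv).symm

theorem subordinand_integral_param {n : ℕ} (x : Rn n) {ξ : Rn n} (hξ : ξ ≠ 0) :
    ∫ v in Ioi (0 : ℝ), subordinand x ξ v = ((√Real.pi / 2 : ℝ) : ℂ) *
      (Complex.exp (Complex.I * ((inner ℝ x ξ : ℝ) : ℂ)) * ((Real.exp (-‖ξ‖) : ℝ) : ℂ)) := by
  unfold subordinand
  rw [integral_const_mul, integral_complex_ofReal, subordination (half_pos (norm_pos_iff.2 hξ)),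
    mul_div_cancel₀ _ two_ne_zero]
  push_cast
  ring

/-- The inverse Fourier transform of `e^{-|ξ|}` is the Poisson kernel. -/
theorem poissonKernel_eq {n : ℕ} (hn : 1 ≤ n) (x : Rn n) :
    ((poissonKernel x : ℝ) : ℂ) = (((2 * Real.pi) ^ n : ℝ) : ℂ)⁻¹ *
      ∫ ξ : Rn n, Complex.exp (Complex.I * ((inner ℝ x ξ : ℝ) : ℂ)) *
        ((Real.exp (-‖ξ‖) : ℝ) : ℂ) := by
  have : Nonempty (Fin n) := ⟨⟨0, hn⟩⟩
  have hswap := integral_integral_swap (f := fun ξ v => subordinand x ξ v) (subordinand_integrable x)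
  have hleft : ∫ ξ : Rn n, ∫ v in Ioi (0 : ℝ), subordinand x ξ v = ((√Real.pi / 2 : ℝ) : ℂ) *
      ∫ ξ : Rn n, Complex.exp (Complex.I * ((inner ℝ x ξ : ℝ) : ℂ)) *
        ((Real.exp (-‖ξ‖) : ℝ) : ℂ) := by
    rw [← integral_const_mul]
    refine integral_congr_ae ?_
    -- The subordination formula is applied with `c = |ξ|/2 > 0`; the excluded origin is a null set
    -- because `n ≥ 1`.
    filter_upwards [Measure.ae_ne volume (0 : Rn n)] with ξ hξ
    exact subordinand_integral_param x hξ
  have hright : ∫ v in Ioi (0 : ℝ), ∫ ξ : Rn n, subordinand x ξ v =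
      (((2 * √Real.pi) ^ n * ((1 + ‖x‖ ^ 2) ^ (-(((n : ℝ) + 1) / 2)) / 2 *
        Real.Gamma (((n : ℝ) + 1) / 2)) : ℝ) : ℂ) := by
    rw [← (moment_gaussian n (b := 1 + ‖x‖ ^ 2) (by positivity)).2, ← integral_complex_ofReal]
    exact setIntegral_congr_fun measurableSet_Ioi fun v hv => (subordinand_integral_freq x hv).2
  rw [hleft, hright] at hswap
  have hpi : (((√Real.pi / 2 : ℝ)) : ℂ) ≠ 0 := by
    exact_mod_cast (by positivity : (√Real.pi / 2 : ℝ) ≠ 0)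
  replace hswap := eq_div_of_mul_eq hpi ((mul_comm _ _).trans hswap)
  rw [hswap, ← Complex.ofReal_div, ← Complex.ofReal_inv, ← Complex.ofReal_mul]
  congr 1
  rw [poissonKernel, poissonConst]
  have h1 : Real.pi ^ (((n : ℝ) + 1) / 2) = √Real.pi ^ n * √Real.pi := by
    rw [← pow_succ, Real.sqrt_eq_rpow, ← Real.rpow_natCast, ← Real.rpow_mul Real.pi_pos.le]
    congr 1
    push_cast
    ring
  have h2 : Real.pi ^ n = √Real.pi ^ n * √Real.pi ^ n := by
    rw [← mul_pow, Real.mul_self_sqrt Real.pi_pos.le]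
  rw [h1, mul_pow, mul_pow, h2]
  have : √Real.pi ≠ 0 := by positivity
  field_simp

/-! ### Splitting `e^{i|ξ|}` into a smooth part and a multiple of `e^{-|ξ|}`. -/

/-- By the ratio test the radius of convergence is infinite, so the sum is analytic on the whole
line. -/
theorem contDiff_tsum_of_ratio {c : ℕ → ℝ} (h0 : ∀ k, c k ≠ 0)
    (h : Tendsto (fun k => ‖c k.succ‖ / ‖c k‖) atTop (𝓝 0)) :
    ContDiff ℝ ∞ fun w : ℝ => ∑' k : ℕ, c k * w ^ k := by
  have hr := FormalMultilinearSeries.ofScalars_radius_eq_top_of_tendsto ℝ c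
    (Eventually.of_forall h0) h
  have hp := (FormalMultilinearSeries.ofScalars ℝ c).hasFPowerSeriesOnBall (by rw [hr]; simp)
  have ha := hp.analyticOnNhd
  rw [hr, Metric.eball_top] at ha
  rw [show (fun w : ℝ => ∑' k : ℕ, c k * w ^ k) = (FormalMultilinearSeries.ofScalars ℝ c).sum from
    funext fun w => (FormalMultilinearSeries.ofScalars_sum_eq c w).symm]
  exact ha.contDiff

/-- The entire function `w ↦ ∑ wᵏ/(2k)!`, which is `cosh √w`. -/
noncomputable def coshSqrt (w : ℝ) : ℝ := ∑' k : ℕ, ((2 * k).factorial : ℝ)⁻¹ * w ^ k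

/-- The entire function `w ↦ ∑ wᵏ/(2k+1)!`, which is `sinh √w / √w`. -/
noncomputable def sinhcSqrt (w : ℝ) : ℝ := ∑' k : ℕ, ((2 * k + 1).factorial : ℝ)⁻¹ * w ^ k

theorem factorial_ratio_tendsto (d : ℕ) :
    Tendsto (fun k : ℕ => ‖((2 * k.succ + d).factorial : ℝ)⁻¹‖ / ‖((2 * k + d).factorial : ℝ)⁻¹‖)
      atTop (𝓝 0) := by
  refine squeeze_zero (fun k => by positivity) (fun k => ?_) tendsto_one_div_add_atTop_nhds_zero_nat
  rw [norm_inv, norm_inv, Real.norm_natCast, Real.norm_natCast,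
    show 2 * k.succ + d = (2 * k + d + 1) + 1 by rw [Nat.succ_eq_add_one]; ring, Nat.factorial_succ,
    Nat.factorial_succ]
  have h : (0 : ℝ) < ((2 * k + d).factorial : ℝ) := by positivity
  push_cast
  rw [div_inv_eq_mul, inv_mul_le_iff₀ (by positivity), mul_one_div, le_div_iff₀ (by positivity)]
  have hk : (0 : ℝ) ≤ k := k.cast_nonneg
  have hd : (0 : ℝ) ≤ d := d.cast_nonneg
  rw [mul_comm, ← mul_assoc]
  refine mul_le_mul_of_nonneg_right ?_ h.le
  nlinarith

theorem coshSqrt_contDiff : ContDiff ℝ ∞ coshSqrt :=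
  contDiff_tsum_of_ratio (fun k => by positivity) (factorial_ratio_tendsto 0)

theorem sinhcSqrt_contDiff : ContDiff ℝ ∞ sinhcSqrt :=
  contDiff_tsum_of_ratio (fun k => by positivity) (factorial_ratio_tendsto 1)

theorem coshSqrt_sq (r : ℝ) : coshSqrt (r ^ 2) = Real.cosh r := by
  rw [← (Real.hasSum_cosh r).tsum_eq, coshSqrt]
  exact tsum_congr fun k => by rw [← pow_mul, div_eq_inv_mul]

theorem coshSqrt_neg_sq (r : ℝ) : coshSqrt (-r ^ 2) = Real.cos r := by
  rw [← (Real.hasSum_cos r).tsum_eq, coshSqrt]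
  exact tsum_congr fun k => by rw [neg_pow, ← pow_mul, div_eq_inv_mul]

theorem sinhcSqrt_sq (r : ℝ) : r * sinhcSqrt (r ^ 2) = Real.sinh r := by
  rw [← (Real.hasSum_sinh r).tsum_eq, sinhcSqrt, ← tsum_mul_left]
  exact tsum_congr fun k => by rw [← pow_mul, div_eq_inv_mul, pow_succ]; ring

theorem sinhcSqrt_neg_sq (r : ℝ) : r * sinhcSqrt (-r ^ 2) = Real.sin r := by
  rw [← (Real.hasSum_sin r).tsum_eq, sinhcSqrt, ← tsum_mul_left]
  exact tsum_congr fun k => by rw [neg_pow, ← pow_mul, div_eq_inv_mul, pow_succ]; ring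

theorem sinhcSqrt_zero : sinhcSqrt 0 = 1 := by
  rw [sinhcSqrt, tsum_eq_single 0]
  · simp
  · intro k hk
    simp [hk]

/-- This permits division by `sinh|ξ|/|ξ|`, at the origin included. -/
theorem sinhcSqrt_sq_pos {r : ℝ} (hr : 0 ≤ r) : 0 < sinhcSqrt (r ^ 2) := by
  rcases hr.eq_or_lt with rfl | hr
  · simp [sinhcSqrt_zero]
  · have h := Real.sinh_pos_iff.2 hr
    rw [← sinhcSqrt_sq] at h
    exact pos_of_mul_pos_right h hr.le

theorem coshSqrt_comp_contDiff {n : ℕ} (s : ℝ) :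
    ContDiff ℝ ∞ fun ξ : Rn n => ((coshSqrt (s * ‖ξ‖ ^ 2) : ℝ) : ℂ) :=
  Complex.ofRealCLM.contDiff.comp
    (coshSqrt_contDiff.comp (contDiff_const.mul (contDiff_norm_sq ℝ)))

theorem sinhcSqrt_comp_contDiff {n : ℕ} (s : ℝ) :
    ContDiff ℝ ∞ fun ξ : Rn n => ((sinhcSqrt (s * ‖ξ‖ ^ 2) : ℝ) : ℂ) :=
  Complex.ofRealCLM.contDiff.comp
    (sinhcSqrt_contDiff.comp (contDiff_const.mul (contDiff_norm_sq ℝ)))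

/-- The smooth factor `-i (sin|ξ|/|ξ|) / (sinh|ξ|/|ξ|)` of `e^{-|ξ|}` in `e^{i|ξ|}`. -/
noncomputable def conicFactor {n : ℕ} (ξ : Rn n) : ℂ :=
  -Complex.I * ((sinhcSqrt (-1 * ‖ξ‖ ^ 2) : ℝ) : ℂ) * ((sinhcSqrt (1 * ‖ξ‖ ^ 2) : ℝ) : ℂ)⁻¹

/-- The smooth part of `e^{i|ξ|}`. -/
noncomputable def smoothFactor {n : ℕ} (ξ : Rn n) : ℂ :=
  ((coshSqrt (-1 * ‖ξ‖ ^ 2) : ℝ) : ℂ) - conicFactor ξ * ((coshSqrt (1 * ‖ξ‖ ^ 2) : ℝ) : ℂ)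

theorem conicFactor_contDiff {n : ℕ} : ContDiff ℝ ∞ (conicFactor (n := n)) := by
  refine (contDiff_const.mul (sinhcSqrt_comp_contDiff _)).mul
    ((sinhcSqrt_comp_contDiff _).inv fun ξ => ?_)
  rw [one_mul]
  exact_mod_cast (sinhcSqrt_sq_pos (norm_nonneg ξ)).ne'

theorem smoothFactor_contDiff {n : ℕ} : ContDiff ℝ ∞ (smoothFactor (n := n)) :=
  (coshSqrt_comp_contDiff _).sub (conicFactor_contDiff.mul (coshSqrt_comp_contDiff _))

theorem conicFactor_zero {n : ℕ} : conicFactor (0 : Rn n) = -Complex.I := by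
  simp [conicFactor, sinhcSqrt_zero]

/-- `e^{i|ξ|}` is, up to smooth factors, a multiple of `e^{-|ξ|}`. -/
theorem exp_I_norm_eq {n : ℕ} (ξ : Rn n) :
    Complex.exp (Complex.I * ((‖ξ‖ : ℝ) : ℂ)) =
      smoothFactor ξ + conicFactor ξ * ((Real.exp (-‖ξ‖) : ℝ) : ℂ) := by
  have hS : ((sinhcSqrt (‖ξ‖ ^ 2) : ℝ) : ℂ) ≠ 0 := by
    exact_mod_cast (sinhcSqrt_sq_pos (norm_nonneg ξ)).ne'
  -- The only nonsmooth ingredient here is the factor `|ξ|`, the same one that multiplies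
  -- `sin|ξ|/|ξ|` in `e^{i|ξ|}`.
  have h1 : Real.exp (-‖ξ‖) = coshSqrt (‖ξ‖ ^ 2) - ‖ξ‖ * sinhcSqrt (‖ξ‖ ^ 2) := by
    rw [coshSqrt_sq, sinhcSqrt_sq, Real.cosh_sub_sinh]
  rw [smoothFactor, mul_comm Complex.I, Complex.exp_mul_I, ← Complex.ofReal_cos,
    ← Complex.ofReal_sin, ← coshSqrt_neg_sq, ← sinhcSqrt_neg_sq, h1, conicFactor, one_mul,
    neg_one_mul]
  push_cast
  field_simp
  ring

/-! ### Expansions and second differences of `(1+|x|²)^{-a}`. -/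

/-- First-order Taylor expansion of `u ↦ (1 + u)^{-a}` at the origin. -/
theorem one_add_rpow_neg_taylor {a : ℝ} (ha : 0 < a) :
    ∃ C : ℝ, 0 ≤ C ∧ ∀ u : ℝ, |u| ≤ 1 / 2 → |(1 + u) ^ (-a) - 1 + a * u| ≤ C * u ^ 2 := by
  -- `K` bounds the second derivative, since `1 + u ≥ 1/2`; the mean value inequality is then
  -- applied twice.
  set K : ℝ := a * (a + 1) * 2 ^ (a + 2) with hK
  have hK0 : 0 ≤ K := by positivity
  have hpos : ∀ v : ℝ, |v| ≤ 1 / 2 → 0 < 1 + v := fun v hv => by linarith [(abs_le.1 hv).1]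
  have hd : ∀ (s v : ℝ), |v| ≤ 1 / 2 →
      HasDerivAt (fun v : ℝ => (1 + v) ^ s) (s * (1 + v) ^ (s - 1)) v := by
    intro s v hv
    have h1 : HasDerivAt (fun v : ℝ => 1 + v) 1 v := (hasDerivAt_id v).const_add 1
    have h := h1.rpow_const (p := s) (Or.inl (hpos v hv).ne')
    simpa using h
  have hd1 : ∀ v : ℝ, |v| ≤ 1 / 2 → HasDerivAt (fun v : ℝ => (1 + v) ^ (-a) - 1 + a * v)
      (-a * (1 + v) ^ (-a - 1) + a) v := by
    intro v hv
    have h := ((hd (-a) v hv).sub_const 1).add ((hasDerivAt_id v).const_mul a)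
    exact h.congr_deriv (by ring)
  have hd2 : ∀ v : ℝ, |v| ≤ 1 / 2 → HasDerivAt (fun v : ℝ => -a * (1 + v) ^ (-a - 1) + a)
      (-a * ((-a - 1) * (1 + v) ^ (-a - 1 - 1))) v := fun v hv =>
    ((hd (-a - 1) v hv).const_mul (-a)).add_const a
  have hb2 : ∀ v : ℝ, |v| ≤ 1 / 2 → ‖-a * ((-a - 1) * (1 + v) ^ (-a - 1 - 1))‖ ≤ K := by
    intro v hv
    have h1 : (1 + v) ^ (-a - 1 - 1) ≤ 2 ^ (a + 2) := by
      have h2 := Real.rpow_le_rpow_of_nonpos (z := -a - 1 - 1) (by norm_num : (0 : ℝ) < 1 / 2)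
        (by linarith [(abs_le.1 hv).1] : 1 / 2 ≤ 1 + v) (by linarith)
      refine h2.trans_eq ?_
      rw [one_div, Real.inv_rpow (by norm_num), ← Real.rpow_neg (by norm_num)]
      congr 1
      ring
    have h3 := Real.rpow_nonneg (hpos v hv).le (-a - 1 - 1)
    rw [show -a * ((-a - 1) * (1 + v) ^ (-a - 1 - 1)) =
      a * (a + 1) * (1 + v) ^ (-a - 1 - 1) by ring, Real.norm_of_nonneg (by positivity)]
    exact mul_le_mul_of_nonneg_left h1 (by positivity)
  have hb1 : ∀ v : ℝ, |v| ≤ 1 / 2 → ‖-a * (1 + v) ^ (-a - 1) + a‖ ≤ K * |v| := by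
    intro v hv
    have h := (convex_Icc (-(1 / 2) : ℝ) (1 / 2)).norm_image_sub_le_of_norm_hasDerivWithin_le
      (fun w hw => (hd2 w (abs_le.2 hw)).hasDerivWithinAt) (fun w hw => hb2 w (abs_le.2 hw))
      (by norm_num : (0 : ℝ) ∈ Icc (-(1 / 2) : ℝ) (1 / 2)) (abs_le.1 hv)
    simpa using h
  refine ⟨K, hK0, fun u hu => ?_⟩
  have hsub : ∀ w ∈ Icc (-|u|) |u|, |w| ≤ 1 / 2 := fun w hw => (abs_le.2 hw).trans hu
  have h := (convex_Icc (-|u|) |u|).norm_image_sub_le_of_norm_hasDerivWithin_le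
    (fun w hw => (hd1 w (hsub w hw)).hasDerivWithinAt)
    (fun w hw => (hb1 w (hsub w hw)).trans
      (mul_le_mul_of_nonneg_left (abs_le.2 hw : |w| ≤ |u|) hK0))
    (⟨neg_nonpos.2 (abs_nonneg u), abs_nonneg u⟩ : (0 : ℝ) ∈ Icc (-|u|) |u|)
    (abs_le.1 le_rfl : u ∈ Icc (-|u|) |u|)
  simpa [mul_assoc, ← sq, sq_abs] using h

/-- Symmetric second differences of `x ↦ (1+|x|²)^{-a}` decay two orders faster. -/
theorem second_difference_bound {n : ℕ} {a : ℝ} (ha : 0 < a) :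
    ∃ C : ℝ, 0 ≤ C ∧ ∀ x y : Rn n,
      |(1 + ‖x - y‖ ^ 2) ^ (-a) + (1 + ‖x + y‖ ^ 2) ^ (-a) - 2 * (1 + ‖x‖ ^ 2) ^ (-a)| ≤
        C * (1 + ‖y‖ ^ 2) ^ (a + 1) * (1 + ‖x‖ ^ 2) ^ (-(a + 1)) := by
  obtain ⟨C, hC0, hC⟩ := one_add_rpow_neg_taylor ha
  -- `20C` collects two Taylor remainders, `2a` the surviving term in `|y|²`, and `4·64^{a+1}` the
  -- crude bound for large `y`.
  refine ⟨20 * C + 2 * a + 4 * 64 ^ (a + 1), by positivity, fun x y => ?_⟩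
  have hx1 : 1 ≤ 1 + ‖x‖ ^ 2 := by nlinarith [norm_nonneg x]
  have hy1 : 1 ≤ 1 + ‖y‖ ^ 2 := by nlinarith [norm_nonneg y]
  have hle1 : ∀ z : Rn n, 0 < (1 + ‖z‖ ^ 2) ^ (-a) ∧ (1 + ‖z‖ ^ 2) ^ (-a) ≤ 1 := fun z =>
    ⟨by positivity, Real.rpow_le_one_of_one_le_of_nonpos (by nlinarith [norm_nonneg z])
      (by linarith)⟩
  set X := 1 + ‖x‖ ^ 2 with hX
  set Y := 1 + ‖y‖ ^ 2 with hY
  have hX0 : 0 < X := by linarith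
  have hY0 : 0 < Y := by linarith
  have hprod : X ^ (-(a + 1)) * Y ^ (a + 1) = (Y / X) ^ (a + 1) := by
    rw [Real.div_rpow hY0.le hX0.le, Real.rpow_neg hX0.le]
    ring
  rw [mul_assoc, mul_comm (Y ^ (a + 1))]
  -- For small `y` the Taylor expansion applies and the linear terms `±2⟨x,y⟩` cancel. Otherwise
  -- `64Y/X ≥ 1`, and the trivial bound `4` is enough.
  rcases le_or_gt (64 * ‖y‖ ^ 2) X with h | h
  · have hcs := abs_le.1 (abs_real_inner_le_norm x y)
    set b : ℝ := inner ℝ x y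
    have hsq : (‖x‖ * ‖y‖) ^ 2 ≤ X * ‖y‖ ^ 2 := by
      rw [mul_pow]
      exact mul_le_mul_of_nonneg_right (by rw [hX]; linarith) (by positivity)
    have hb2 : b ^ 2 ≤ X * ‖y‖ ^ 2 := (sq_le_sq' hcs.1 hcs.2).trans hsq
    have hb8 : |b| ≤ X / 8 := by
      refine abs_le_of_sq_le_sq ?_ (by positivity)
      nlinarith
    have hb8' := abs_le.1 hb8
    have hterm : ∀ e : ℝ, e ^ 2 = 1 → ∀ z : Rn n, ‖z‖ ^ 2 = ‖x‖ ^ 2 + ‖y‖ ^ 2 + e * (2 * b) →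
        |(1 + ‖z‖ ^ 2) ^ (-a) - X ^ (-a) * (1 - a * ((‖y‖ ^ 2 + e * (2 * b)) / X))| ≤
          X ^ (-a) * (C * (10 * (‖y‖ ^ 2 / X))) := by
      intro e he z hz
      set u := (‖y‖ ^ 2 + e * (2 * b)) / X with hu
      have heabs : |e| = 1 := (pow_eq_one_iff_of_nonneg (abs_nonneg e) two_ne_zero).1 (by rw [sq_abs, he])
      have huX : u * X = ‖y‖ ^ 2 + e * (2 * b) := div_mul_cancel₀ _ hX0.ne'
      have hu2 : |u| ≤ 1 / 2 := by
        rw [hu, abs_div, abs_of_pos hX0, div_le_iff₀ hX0]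
        refine (abs_add_le _ _).trans ?_
        rw [abs_mul, heabs, abs_mul, abs_two, abs_of_nonneg (by positivity)]
        linarith
      have hz' : 1 + ‖z‖ ^ 2 = X * (1 + u) := by
        rw [mul_add, mul_comm X u, huX, hz, hX]
        ring
      have h1u : 0 ≤ 1 + u := by linarith [(abs_le.1 hu2).1]
      rw [hz', Real.mul_rpow hX0.le h1u, ← mul_sub, abs_mul, abs_of_pos (hle1 x).1]
      refine mul_le_mul_of_nonneg_left ?_ (hle1 x).1.le
      have h5 := hC u hu2
      rw [show (1 + u) ^ (-a) - (1 - a * u) = (1 + u) ^ (-a) - 1 + a * u by ring]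
      refine h5.trans (mul_le_mul_of_nonneg_left ?_ hC0)
      -- `(p+q)² ≤ 2p² + 2q²` with `p² = |y|⁴ ≤ |y|²X` and `q² = 4b² ≤ 4|y|²X` yields `10`.
      have h6 : (u * X) ^ 2 ≤ 10 * (‖y‖ ^ 2 * X) := by
        rw [huX]
        have h7 : (e * (2 * b)) ^ 2 = 4 * b ^ 2 := by rw [mul_pow, he]; ring
        have h8 : ‖y‖ ^ 2 * ‖y‖ ^ 2 ≤ ‖y‖ ^ 2 * X :=
          mul_le_mul_of_nonneg_left (by nlinarith [sq_nonneg ‖y‖]) (by positivity)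
        nlinarith [sq_nonneg (‖y‖ ^ 2 - e * (2 * b))]
      have h9 : u ^ 2 * X ^ 2 ≤ (10 * (‖y‖ ^ 2 / X)) * X ^ 2 := by
        rw [← mul_pow]
        refine h6.trans_eq ?_
        field_simp
      exact le_of_mul_le_mul_right h9 (by positivity)
    have hm := hterm (-1) (by norm_num) (x - y) (by rw [norm_sub_sq_real]; ring)
    have hp := hterm 1 (by norm_num) (x + y) (by rw [norm_add_sq_real]; ring)
    have hsum : (1 + ‖x - y‖ ^ 2) ^ (-a) + (1 + ‖x + y‖ ^ 2) ^ (-a) - 2 * X ^ (-a) =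
        ((1 + ‖x - y‖ ^ 2) ^ (-a) -
          X ^ (-a) * (1 - a * ((‖y‖ ^ 2 + -1 * (2 * b)) / X))) +
        ((1 + ‖x + y‖ ^ 2) ^ (-a) - X ^ (-a) * (1 - a * ((‖y‖ ^ 2 + 1 * (2 * b)) / X))) +
        -(X ^ (-a) * (2 * a * (‖y‖ ^ 2 / X))) := by
      field_simp
      ring
    have hXa := (hle1 x).1
    have hD : 0 ≤ ‖y‖ ^ 2 / X := by positivity
    have htot : |(1 + ‖x - y‖ ^ 2) ^ (-a) + (1 + ‖x + y‖ ^ 2) ^ (-a) - 2 * X ^ (-a)| ≤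
        (20 * C + 2 * a) * (X ^ (-a) * (‖y‖ ^ 2 / X)) := by
      rw [hsum]
      refine (abs_add_le _ _).trans ((add_le_add ((abs_add_le _ _).trans (add_le_add hm hp))
        le_rfl).trans ?_)
      rw [abs_neg, abs_of_nonneg (by positivity)]
      exact le_of_eq (by ring)
    refine htot.trans (mul_le_mul ?_ ?_ (by positivity) (by positivity))
    · have : (0 : ℝ) ≤ 4 * 64 ^ (a + 1) := by positivity
      linarith
    · have h1 : X ^ (-(a + 1)) = X ^ (-a) / X := by
        rw [neg_add, ← sub_eq_add_neg, Real.rpow_sub hX0, Real.rpow_one]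
      rw [h1, div_mul_eq_mul_div, mul_div_assoc']
      gcongr
      calc ‖y‖ ^ 2 ≤ Y := by rw [hY]; linarith
        _ = Y ^ (1 : ℝ) := (Real.rpow_one _).symm
        _ ≤ Y ^ (a + 1) := Real.rpow_le_rpow_of_exponent_le hy1 (by linarith)
  · have h1 := hle1 (x - y)
    have h2 := hle1 (x + y)
    have h3 := hle1 x
    have h4 : |(1 + ‖x - y‖ ^ 2) ^ (-a) + (1 + ‖x + y‖ ^ 2) ^ (-a) - 2 * X ^ (-a)| ≤ 4 := by
      rw [abs_le]
      constructor <;> linarith [h1.1, h1.2, h2.1, h2.2, h3.1, h3.2]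
    refine h4.trans ?_
    have h5 : 1 ≤ 64 ^ (a + 1) * (Y / X) ^ (a + 1) := by
      rw [← Real.mul_rpow (by norm_num) (by positivity)]
      refine Real.one_le_rpow ?_ (by linarith)
      rw [mul_div_assoc', one_le_div hX0]
      linarith
    rw [hprod]
    have h6 : 0 ≤ (Y / X) ^ (a + 1) := by positivity
    nlinarith [mul_nonneg (by positivity : (0 : ℝ) ≤ 20 * C + 2 * a) h6]

/-- Leading term of `(1+r²)^{-a}` for large `r`. -/
theorem one_add_sq_rpow_expansion {a : ℝ} (ha : 0 < a) :
    ∃ C : ℝ, 0 ≤ C ∧ ∀ r : ℝ, 2 ≤ r →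
      |(1 + r ^ 2) ^ (-a) - (r ^ 2) ^ (-a)| ≤ C * (r ^ 2) ^ (-(a + 1)) := by
  obtain ⟨C, hC0, hC⟩ := one_add_rpow_neg_taylor ha
  refine ⟨C + a, by positivity, fun r hr => ?_⟩
  have hr2 : 0 < r ^ 2 := by positivity
  set u := (r ^ 2)⁻¹ with hu
  have hu0 : 0 < u := inv_pos.2 hr2
  have hu1 : u ≤ 1 / 2 := by
    rw [hu, one_div]
    exact inv_anti₀ (by norm_num) (by nlinarith)
  have h := hC u (by rwa [abs_of_pos hu0])
  have hb : |(1 + u) ^ (-a) - 1| ≤ (C + a) * u := by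
    have h2 := abs_le.1 h
    have h3 : C * u ^ 2 ≤ C * u := mul_le_mul_of_nonneg_left (by nlinarith) hC0
    have h4 : 0 < a * u := by positivity
    rw [abs_le]
    constructor <;> linarith [h2.1, h2.2]
  have he : 1 + r ^ 2 = r ^ 2 * (1 + u) := by
    rw [hu]
    field_simp
    ring
  rw [he, Real.mul_rpow hr2.le (by positivity), ← mul_sub_one, abs_mul,
    abs_of_pos (by positivity), neg_add, ← sub_eq_add_neg, Real.rpow_sub hr2, Real.rpow_one,
    div_eq_mul_inv]
  calc _ ≤ (r ^ 2) ^ (-a) * ((C + a) * u) := mul_le_mul_of_nonneg_left hb (by positivity)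
    _ = _ := by rw [hu]; ring

/-! ### Convolution with the Poisson kernel. -/

/-- Up to a constant this is a marginal of the subordinand at `x = 0`, which is integrable on the
product space. -/
theorem exp_neg_norm_integrable {n : ℕ} (hn : 1 ≤ n) :
    Integrable fun ξ : Rn n => ((Real.exp (-‖ξ‖) : ℝ) : ℂ) := by
  have : Nonempty (Fin n) := ⟨⟨0, hn⟩⟩
  have h := (subordinand_integrable (0 : Rn n)).integral_prod_left
  have hpi : (((√Real.pi / 2 : ℝ)) : ℂ) ≠ 0 := by
    exact_mod_cast (by positivity : (√Real.pi / 2 : ℝ) ≠ 0)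
  refine (h.const_mul (((√Real.pi / 2 : ℝ)) : ℂ)⁻¹).congr ?_
  filter_upwards [Measure.ae_ne volume (0 : Rn n)] with ξ hξ
  rw [subordinand_integral_param 0 hξ, inv_mul_cancel_left₀ hpi]
  simp

theorem norm_exp_I_mul (t : ℝ) : ‖Complex.exp (Complex.I * (t : ℂ))‖ = 1 := by
  rw [mul_comm, Complex.norm_exp_ofReal_mul_I]

theorem hat_integrable' {n : ℕ} (f : 𝓢(Rn n, ℂ)) : Integrable (hat (f : Rn n → ℂ)) := by
  have h := hat_integrable f 0
  simp only [pow_zero, one_mul] at h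
  exact (integrable_norm_iff (hat_contDiff f).continuous.aestronglyMeasurable).1 h

theorem integrable_exp_mul {n : ℕ} {g : Rn n → ℂ} (hg : Integrable g) (x : Rn n) :
    Integrable fun ξ : Rn n => Complex.exp (Complex.I * ((inner ℝ x ξ : ℝ) : ℂ)) * g ξ := by
  refine hg.bdd_mul (c := 1) (Continuous.aestronglyMeasurable (by fun_prop))
    (Eventually.of_forall fun ξ => (norm_exp_I_mul _).le)

/-- The multiplier `e^{-|D|}` is convolution with the Poisson kernel. -/
theorem poisson_convolution {n : ℕ} (hn : 1 ≤ n) (g : 𝓢(Rn n, ℂ)) (x : Rn n) :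
    (((2 * Real.pi) ^ n : ℝ) : ℂ)⁻¹ *
      ∫ ξ : Rn n, Complex.exp (Complex.I * ((inner ℝ x ξ : ℝ) : ℂ)) *
        (((Real.exp (-‖ξ‖) : ℝ) : ℂ) * hat g ξ) =
      ∫ y : Rn n, g y * ((poissonKernel (x - y) : ℝ) : ℂ) := by
  set F : Rn n → Rn n → ℂ := fun ξ y => ((Real.exp (-‖ξ‖) : ℝ) : ℂ) * g y *
    (Complex.exp (Complex.I * ((inner ℝ (x - y) ξ : ℝ) : ℂ))) with hF
  have hint : Integrable (Function.uncurry F) (volume.prod volume) := by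
    refine ((exp_neg_norm_integrable hn).mul_prod g.integrable).mul_bdd (c := 1)
      (Continuous.aestronglyMeasurable (by fun_prop)) (Eventually.of_forall fun z =>
        (norm_exp_I_mul _).le)
  have hswap := integral_integral_swap hint
  have hleft : ∀ ξ : Rn n, ∫ y : Rn n, F ξ y =
      Complex.exp (Complex.I * ((inner ℝ x ξ : ℝ) : ℂ)) *
        (((Real.exp (-‖ξ‖) : ℝ) : ℂ) * hat g ξ) := by
    intro ξ
    rw [hat, ← integral_const_mul, ← integral_const_mul]
    congr 1
    ext y
    simp only [hF]
    rw [inner_sub_left, Complex.ofReal_sub, mul_sub, sub_eq_add_neg, Complex.exp_add]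
    ring
  simp only [hleft] at hswap
  rw [hswap, ← integral_const_mul]
  congr 1
  ext y
  rw [poissonKernel_eq hn, hF, ← integral_const_mul, ← integral_const_mul, ← integral_const_mul]
  congr 1
  ext ξ
  ring

theorem poissonConst_pos (n : ℕ) : 0 < poissonConst n := by
  have := Real.Gamma_pos_of_pos (by positivity : 0 < ((n : ℝ) + 1) / 2)
  unfold poissonConst
  positivity

theorem poissonKernel_bound {n : ℕ} (x : Rn n) :
    0 ≤ poissonKernel x ∧ poissonKernel x ≤ poissonConst n := by
  have hc : 0 ≤ poissonConst n := (poissonConst_pos n).le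
  refine ⟨mul_nonneg hc (by positivity), mul_le_of_le_one_right hc ?_⟩
  refine Real.rpow_le_one_of_one_le_of_nonpos (by nlinarith [norm_nonneg x]) ?_
  have : (0 : ℝ) ≤ n := n.cast_nonneg
  linarith

theorem poissonKernel_continuous {n : ℕ} : Continuous (poissonKernel (n := n)) := by
  unfold poissonKernel
  refine continuous_const.mul (Continuous.rpow_const (by fun_prop) fun x => Or.inl ?_)
  positivity

theorem integrable_mul_poissonKernel {n : ℕ} (g : 𝓢(Rn n, ℂ)) {h : Rn n → Rn n}
    (hh : Continuous h) :
    Integrable fun y : Rn n => g y * ((poissonKernel (h y) : ℝ) : ℂ) := by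
  refine g.integrable.mul_bdd (c := poissonConst n) (Continuous.aestronglyMeasurable
    (Complex.continuous_ofReal.comp (poissonKernel_continuous.comp hh)))
    (Eventually.of_forall fun y => ?_)
  rw [Complex.norm_real, Real.norm_of_nonneg (poissonKernel_bound _).1]
  exact (poissonKernel_bound _).2

theorem schwartz_one_add_sq_integrable {n : ℕ} (g : 𝓢(Rn n, ℂ)) (N : ℕ) :
    Integrable fun y : Rn n => ‖g y‖ * (1 + ‖y‖ ^ 2) ^ N := by
  have : (fun y : Rn n => ‖g y‖ * (1 + ‖y‖ ^ 2) ^ N) = fun y =>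
      ∑ j ∈ Finset.range (N + 1), (N.choose j : ℝ) * (‖y‖ ^ (2 * (N - j)) * ‖g y‖) := by
    ext y
    rw [add_pow, Finset.mul_sum]
    refine Finset.sum_congr rfl fun j _ => ?_
    rw [one_pow, ← pow_mul]
    ring
  rw [this]
  exact integrable_finsetSum _ fun j _ => (g.integrable_pow_mul volume _).const_mul _

/-- Convolution of an even Schwartz function with the Poisson kernel, to second order. -/
theorem poisson_convolution_expansion {n : ℕ} (g : 𝓢(Rn n, ℂ)) (hg : ∀ y, g (-y) = g y) :
    ∃ C : ℝ, 0 ≤ C ∧ ∀ x : Rn n,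
      ‖(∫ y : Rn n, g y * ((poissonKernel (x - y) : ℝ) : ℂ)) -
        ((poissonKernel x : ℝ) : ℂ) * ∫ y : Rn n, g y‖ ≤
      C * (1 + ‖x‖ ^ 2) ^ (-(((n : ℝ) + 1) / 2 + 1)) := by
  have ha : 0 < ((n : ℝ) + 1) / 2 := by positivity
  obtain ⟨C, hC0, hC⟩ := second_difference_bound (n := n) ha
  have hc0 : 0 ≤ poissonConst n := (poissonConst_pos n).le
  have hI := schwartz_one_add_sq_integrable g (n + 2)
  set J := ∫ y : Rn n, ‖g y‖ * (1 + ‖y‖ ^ 2) ^ (n + 2)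
  have hJ : 0 ≤ J := integral_nonneg fun y => by positivity
  refine ⟨poissonConst n * C / 2 * J, by positivity, fun x => ?_⟩
  -- Evenness of `g` allows `P(x-y)` to be averaged with `P(x+y)`, so the first-order term of the
  -- expansion disappears.
  have hsymm : ∫ y : Rn n, g y * ((poissonKernel (x - y) : ℝ) : ℂ) =
      ∫ y : Rn n, g y * ((poissonKernel (x + y) : ℝ) : ℂ) := by
    rw [← integral_neg_eq_self]
    simp only [hg, sub_neg_eq_add]
  have hm := integrable_mul_poissonKernel g (h := fun y => x - y) (by fun_prop)
  have hp := integrable_mul_poissonKernel g (h := fun y => x + y) (by fun_prop)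
  have h0 := integrable_mul_poissonKernel g (h := fun _ => x) (by fun_prop)
  have heq : (∫ y : Rn n, g y * ((poissonKernel (x - y) : ℝ) : ℂ)) -
      ((poissonKernel x : ℝ) : ℂ) * ∫ y : Rn n, g y =
      ∫ y : Rn n, g y * (((poissonKernel (x - y) + poissonKernel (x + y) -
        2 * poissonKernel x) / 2 : ℝ) : ℂ) := by
    have h1 : (∫ y : Rn n, g y * ((poissonKernel (x - y) : ℝ) : ℂ)) =
        ((∫ y : Rn n, g y * ((poissonKernel (x - y) : ℝ) : ℂ)) +
        ∫ y : Rn n, g y * ((poissonKernel (x + y) : ℝ) : ℂ)) / 2 := by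
      rw [← hsymm]; ring
    rw [h1, ← integral_add hm hp, ← integral_div, ← integral_const_mul, ← integral_sub]
    · congr 1
      ext y
      push_cast
      ring
    · exact (hm.add hp).div_const 2
    · simpa only [mul_comm] using h0
  rw [heq, mul_right_comm, mul_comm _ J, ← integral_mul_const]
  refine norm_integral_le_of_norm_le (hI.mul_const _) (Eventually.of_forall fun y => ?_)
  have hb := hC x y
  have hy1 : 1 ≤ 1 + ‖y‖ ^ 2 := by nlinarith [norm_nonneg y]
  have hpow : (1 + ‖y‖ ^ 2) ^ (((n : ℝ) + 1) / 2 + 1) ≤ (1 + ‖y‖ ^ 2) ^ (n + 2) := by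
    rw [← Real.rpow_natCast _ (n + 2)]
    refine Real.rpow_le_rpow_of_exponent_le hy1 ?_
    have : (0 : ℝ) ≤ n := n.cast_nonneg
    push_cast
    linarith
  rw [norm_mul, Complex.norm_real, Real.norm_eq_abs]
  simp only [poissonKernel]
  rw [show (poissonConst n * (1 + ‖x - y‖ ^ 2) ^ (-(((n : ℝ) + 1) / 2)) +
    poissonConst n * (1 + ‖x + y‖ ^ 2) ^ (-(((n : ℝ) + 1) / 2)) -
    2 * (poissonConst n * (1 + ‖x‖ ^ 2) ^ (-(((n : ℝ) + 1) / 2)))) / 2 = poissonConst n / 2 *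
    ((1 + ‖x - y‖ ^ 2) ^ (-(((n : ℝ) + 1) / 2)) + (1 + ‖x + y‖ ^ 2) ^ (-(((n : ℝ) + 1) / 2)) -
    2 * (1 + ‖x‖ ^ 2) ^ (-(((n : ℝ) + 1) / 2))) by ring, abs_mul, abs_of_nonneg (by positivity)]
  calc _ ≤ ‖g y‖ * (poissonConst n / 2 * (C * (1 + ‖y‖ ^ 2) ^ (n + 2) *
        (1 + ‖x‖ ^ 2) ^ (-(((n : ℝ) + 1) / 2 + 1)))) := by
        gcongr
        exact hb.trans (by gcongr)
    _ = _ := by ring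

/-! ### Asymptotics of `Tf` at infinity. -/

/-- `T f` is, up to a Schwartz function, a Schwartz function convolved with the Poisson kernel. -/
theorem fio_norm_decomposition {n : ℕ} (hn : 1 ≤ n) (f : 𝓢(Rn n, ℂ))
    (hc : HasCompactSupport (hat f)) (hr : ∀ x y : Rn n, ‖x‖ = ‖y‖ → f x = f y) :
    ∃ a b : 𝓢(Rn n, ℂ), (∀ y, b (-y) = b y) ∧ ∫ y, b y = -Complex.I * hat f 0 ∧
      ∀ x, fio (fun _ _ => 1) (fun ξ => ‖ξ‖) f x =
        a x + ∫ y : Rn n, b y * ((poissonKernel (x - y) : ℝ) : ℂ) := by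
  obtain ⟨a, ha⟩ := exists_hat_eq (fun ξ => smoothFactor ξ * hat f ξ) hc.mul_left
    (smoothFactor_contDiff.mul (hat_contDiff f))
  obtain ⟨b, hb⟩ := exists_hat_eq (fun ξ => conicFactor ξ * hat f ξ) hc.mul_left
    (conicFactor_contDiff.mul (hat_contDiff f))
  refine ⟨a, b, fun y => radial_of_hat_radial (fun ξ η h => ?_) _ _ (norm_neg y), ?_, fun x => ?_⟩
  · simp only [hb, conicFactor, h, hat_radial hr ξ η h]
  -- `∫ b` is the value at `0` of `c f̂`, and `c(0) = -i`.
  · have h := congrFun hb 0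
    simp only [hat, inner_zero_right, conicFactor_zero] at h
    simpa [hat] using h
  · rw [hat_inversion a x, ← poisson_convolution hn b x, ← mul_add, fio, ← integral_add]
    · congr 2
      ext ξ
      rw [ha, hb, Complex.ofReal_add, mul_add, Complex.exp_add, exp_I_norm_eq]
      ring
    · exact integrable_exp_mul (hat_integrable' a) x
    · refine integrable_exp_mul ?_ x
      refine (hat_integrable' b).bdd_mul (c := 1) (Continuous.aestronglyMeasurable (by fun_prop))
        (Eventually.of_forall fun ξ => ?_)
      rw [Complex.norm_real, Real.norm_of_nonneg (Real.exp_pos _).le]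
      exact Real.exp_le_one_iff.2 (neg_nonpos.2 (norm_nonneg ξ))

theorem sq_rpow_neg_half (r : ℝ) (hr : 0 ≤ r) (k : ℕ) :
    (r ^ 2) ^ (-((k : ℝ) / 2)) = (r ^ k)⁻¹ := by
  rw [Real.rpow_neg (by positivity), ← Real.rpow_natCast r 2, ← Real.rpow_mul hr,
    ← Real.rpow_natCast r k]
  congr 2
  push_cast
  ring

/-- The leading coefficient of `T f` at infinity. -/
theorem leadingCoeff_eq (n : ℕ) (c : ℂ) :
    (Real.Gamma (((n : ℝ) + 1) / 2) : ℂ) * c /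
      (((Real.pi ^ (((n : ℝ) + 1) / 2) : ℝ) : ℂ) * Complex.I) =
    (poissonConst n : ℂ) * (-Complex.I * c) := by
  rw [poissonConst, Complex.ofReal_div, div_mul_eq_div_div_swap, mul_div_assoc, Complex.div_I]
  ring

/-- Three errors of size `|x|^{-n-3}` add up: the Schwartz part `a`, the expansion of `b * P`, and
the replacement of `1+|x|²` by `|x|²` in `P`. -/
theorem fio_norm_asymptotics {n : ℕ} (hn : 1 ≤ n) (f : 𝓢(Rn n, ℂ)) (hf : IsRadialBandLimited f) :
    ∃ C : ℝ, 0 ≤ C ∧ ∀ x : Rn n, 2 ≤ ‖x‖ →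
      ‖fio (fun _ _ => 1) (fun ξ => ‖ξ‖) f x -
        (poissonConst n : ℂ) * (-Complex.I * hat f 0) * ((‖x‖ ^ (n + 1))⁻¹ : ℝ)‖ ≤
      C * (‖x‖ ^ (n + 3))⁻¹ := by
  obtain ⟨a, b, hbe, hbi, hab⟩ := fio_norm_decomposition hn f hf.hat_compact hf.radial
  obtain ⟨C₁, hC₁, h₁⟩ := a.decay (n + 3) 0
  obtain ⟨C₂, hC₂, h₂⟩ := poisson_convolution_expansion b hbe
  obtain ⟨C₃, hC₃, h₃⟩ := one_add_sq_rpow_expansion (by positivity : 0 < ((n : ℝ) + 1) / 2)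
  have hc0 : 0 ≤ poissonConst n := (poissonConst_pos n).le
  refine ⟨C₁ + C₂ + poissonConst n * C₃ * ‖-Complex.I * hat f 0‖, by positivity, fun x hx => ?_⟩
  have hx0 : 0 < ‖x‖ := by linarith
  have e1 : (‖x‖ ^ 2) ^ (-(((n : ℝ) + 1) / 2)) = (‖x‖ ^ (n + 1))⁻¹ := by
    rw [← sq_rpow_neg_half _ hx0.le]
    push_cast
    rfl
  have e3 : (‖x‖ ^ 2) ^ (-(((n : ℝ) + 1) / 2 + 1)) = (‖x‖ ^ (n + 3))⁻¹ := by
    rw [← sq_rpow_neg_half _ hx0.le]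
    congr 2
    push_cast
    ring
  have k1 : ‖a x‖ ≤ C₁ * (‖x‖ ^ (n + 3))⁻¹ := by
    have h := h₁ x
    rw [norm_iteratedFDeriv_zero] at h
    rw [← div_eq_mul_inv, le_div_iff₀' (by positivity)]
    exact h
  have k2 : ‖(∫ y : Rn n, b y * ((poissonKernel (x - y) : ℝ) : ℂ)) -
      ((poissonKernel x : ℝ) : ℂ) * (-Complex.I * hat f 0)‖ ≤ C₂ * (‖x‖ ^ (n + 3))⁻¹ := by
    have h := h₂ x
    rw [hbi] at h
    refine h.trans (mul_le_mul_of_nonneg_left ?_ hC₂)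
    rw [← e3]
    refine Real.rpow_le_rpow_of_nonpos (by positivity) (by linarith) ?_
    have : (0 : ℝ) ≤ n := n.cast_nonneg
    linarith
  have k3 : |poissonKernel x - poissonConst n * (‖x‖ ^ (n + 1))⁻¹| ≤
      poissonConst n * C₃ * (‖x‖ ^ (n + 3))⁻¹ := by
    have h := h₃ ‖x‖ hx
    rw [e1, e3] at h
    rw [poissonKernel, ← mul_sub, abs_mul, abs_of_nonneg hc0, mul_assoc]
    exact mul_le_mul_of_nonneg_left h hc0
  rw [hab x, show a x + (∫ y : Rn n, b y * ((poissonKernel (x - y) : ℝ) : ℂ)) -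
      (poissonConst n : ℂ) * (-Complex.I * hat f 0) * ((‖x‖ ^ (n + 1))⁻¹ : ℝ) =
      a x + ((∫ y : Rn n, b y * ((poissonKernel (x - y) : ℝ) : ℂ)) -
        ((poissonKernel x : ℝ) : ℂ) * (-Complex.I * hat f 0)) +
      ((poissonKernel x - poissonConst n * (‖x‖ ^ (n + 1))⁻¹ : ℝ) : ℂ) *
        (-Complex.I * hat f 0) by push_cast; ring]
  refine (norm_add_le _ _).trans ((add_le_add ((norm_add_le _ _).trans (add_le_add k1 k2))
    (norm_mul_le _ _)).trans ?_)
  rw [Complex.norm_real, Real.norm_eq_abs]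
  have k4 := mul_le_mul_of_nonneg_right k3 (norm_nonneg (-Complex.I * hat f 0))
  linarith

/-- The logarithm is mere slack: `1 + log|x| ≥ 1` for `|x| ≥ 2`. -/
theorem fio_norm_isBigO {n : ℕ} (hn : 1 ≤ n) (f : 𝓢(Rn n, ℂ)) (hf : IsRadialBandLimited f) :
    (fun x : Rn n =>
        fio (fun _ _ => 1) (fun ξ => ‖ξ‖) f x -
          (Real.Gamma (((n : ℝ) + 1) / 2) : ℂ) * hat f 0 /
            (((Real.pi ^ (((n : ℝ) + 1) / 2) : ℝ) : ℂ) * Complex.I) *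
              ((‖x‖ ^ (n + 1))⁻¹ : ℝ))
      =O[Bornology.cobounded (Rn n)]
        (fun x : Rn n => (1 + Real.log ‖x‖) / ‖x‖ ^ (n + 3)) := by
  obtain ⟨C, hC0, hC⟩ := fio_norm_asymptotics hn f hf
  refine Asymptotics.IsBigO.of_bound C ?_
  filter_upwards [tendsto_norm_cobounded_atTop.eventually_ge_atTop 2] with x hx
  rw [leadingCoeff_eq]
  refine (hC x hx).trans (mul_le_mul_of_nonneg_left ?_ hC0)
  have hl : 0 ≤ Real.log ‖x‖ := Real.log_nonneg (by linarith)
  rw [Real.norm_of_nonneg (by positivity), div_eq_mul_inv]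
  exact le_mul_of_one_le_left (by positivity) (by linarith)

/-! ### Failure of `p`-integrability. -/

/-- As `(n+1)p ≤ n`, `|F|^p` dominates a multiple of `|x|^{-n}` on `|x| ≥ R`; in polar coordinates
this is `r^{n-1} r^{-n} = 1/r`, which diverges. -/
theorem lintegral_rpow_eq_top_of_lower_bound {n : ℕ} (hn : 1 ≤ n) {F : Rn n → ℂ} {c R p : ℝ}
    (hc : 0 < c) (hR : 1 ≤ R) (hp : 0 < p) (hpn : p ≤ (n : ℝ) / (n + 1))
    (hF : ∀ x, R ≤ ‖x‖ → c * (‖x‖ ^ (n + 1))⁻¹ ≤ ‖F x‖) :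
    ∫⁻ x : Rn n, ‖F x‖ₑ ^ p = ⊤ := by
  have : Nonempty (Fin n) := ⟨⟨0, hn⟩⟩
  by_contra htop
  set G : ℝ → ℝ := (Ici R).indicator fun r => (r ^ n)⁻¹ with hG
  have hGm : Measurable G := Measurable.indicator (by fun_prop) measurableSet_Ici
  have hbound : ∀ x : Rn n, ‖G ‖x‖‖ₑ ≤ ENNReal.ofReal ((c ^ p)⁻¹) * ‖F x‖ₑ ^ p := by
    intro x
    by_cases hx : R ≤ ‖x‖
    · have hx1 : 1 ≤ ‖x‖ := hR.trans hx
      have hx0 : 0 < ‖x‖ := by linarith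
      rw [hG, indicator_of_mem (mem_Ici.2 hx), ← ofReal_norm, ← ofReal_norm,
        ENNReal.ofReal_rpow_of_nonneg (norm_nonneg _) hp.le,
        ← ENNReal.ofReal_mul (by positivity)]
      refine ENNReal.ofReal_le_ofReal ?_
      rw [Real.norm_of_nonneg (by positivity)]
      have h1 := Real.rpow_le_rpow (by positivity) (hF x hx) hp.le
      rw [Real.mul_rpow hc.le (by positivity)] at h1
      have h2 : (‖x‖ ^ n)⁻¹ ≤ ((‖x‖ ^ (n + 1))⁻¹) ^ p := by
        rw [Real.inv_rpow (by positivity), ← Real.rpow_natCast _ n, ← Real.rpow_natCast _ (n + 1),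
          ← Real.rpow_mul hx0.le]
        refine inv_anti₀ (by positivity) (Real.rpow_le_rpow_of_exponent_le hx1 ?_)
        rw [le_div_iff₀ (by positivity)] at hpn
        push_cast
        linarith
      rw [inv_mul_eq_div, le_div_iff₀' (by positivity)]
      exact (mul_le_mul_of_nonneg_left h2 (by positivity)).trans h1
    · rw [hG, indicator_of_notMem (by simpa using hx)]
      simp
  have hint : Integrable (fun x : Rn n => G ‖x‖) := by
    refine ⟨(hGm.comp measurable_norm).aestronglyMeasurable, ?_⟩
    refine (lintegral_mono hbound).trans_lt ?_
    rw [lintegral_const_mul' _ _ ENNReal.ofReal_ne_top]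
    exact ENNReal.mul_lt_top ENNReal.ofReal_lt_top (lt_top_iff_ne_top.2 htop)
  rw [integrable_fun_norm_addHaar, finrank_euclideanSpace_fin] at hint
  refine not_integrableOn_Ioi_inv (a := R) ?_
  refine (hint.mono_set (Ioi_subset_Ioi (by linarith))).congr_fun (fun y hy => ?_)
    measurableSet_Ioi
  have hy0 : 0 < y := by linarith [mem_Ioi.1 hy]
  simp only [hG]
  rw [indicator_of_mem (mem_Ici.2 (mem_Ioi.1 hy).le), smul_eq_mul]
  obtain ⟨m, rfl⟩ := Nat.exists_eq_add_of_le' hn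
  rw [Nat.add_sub_cancel, pow_succ]
  field_simp

theorem IsRadialBandLimited.hat_zero {n : ℕ} {f : 𝓢(Rn n, ℂ)} (hf : IsRadialBandLimited f) :
    hat (f : Rn n → ℂ) 0 = 1 :=
  hf.hat_eq_one.self_of_nhds

theorem fio_norm_lower_bound {n : ℕ} (hn : 1 ≤ n) (f : 𝓢(Rn n, ℂ)) (hf : IsRadialBandLimited f) :
    ∃ c R : ℝ, 0 < c ∧ 1 ≤ R ∧ ∀ x : Rn n, R ≤ ‖x‖ →
      c * (‖x‖ ^ (n + 1))⁻¹ ≤ ‖fio (fun _ _ => 1) (fun ξ => ‖ξ‖) f x‖ := by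
  obtain ⟨C, hC0, hC⟩ := fio_norm_asymptotics hn f hf
  have hc := poissonConst_pos n
  -- Beyond this radius `C ≤ (poissonConst n / 2) |x|²`, so the error takes at most half of the
  -- leading term.
  refine ⟨poissonConst n / 2, 2 + 2 * C / poissonConst n, by positivity, ?_, fun x hx => ?_⟩
  · have : 0 ≤ 2 * C / poissonConst n := by positivity
    linarith
  have hq : 0 ≤ 2 * C / poissonConst n := by positivity
  have hx2 : 2 ≤ ‖x‖ := by linarith
  have hx0 : 0 < ‖x‖ := by linarith
  have h := hC x hx2
  rw [hf.hat_zero, mul_one] at h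
  have hmain : ‖(poissonConst n : ℂ) * -Complex.I * ((‖x‖ ^ (n + 1))⁻¹ : ℝ)‖ =
      poissonConst n * (‖x‖ ^ (n + 1))⁻¹ := by
    rw [norm_mul, norm_mul, norm_neg, Complex.norm_I, mul_one, Complex.norm_real,
      Complex.norm_real, Real.norm_of_nonneg hc.le, Real.norm_of_nonneg (by positivity)]
  have herr : C * (‖x‖ ^ (n + 3))⁻¹ ≤ poissonConst n / 2 * (‖x‖ ^ (n + 1))⁻¹ := by
    have h1 : C ≤ poissonConst n / 2 * ‖x‖ ^ 2 := by
      have h2 : 2 * C / poissonConst n ≤ ‖x‖ ^ 2 := by nlinarith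
      rw [div_le_iff₀ hc] at h2
      linarith
    calc C * (‖x‖ ^ (n + 3))⁻¹ ≤ poissonConst n / 2 * ‖x‖ ^ 2 * (‖x‖ ^ (n + 3))⁻¹ :=
          mul_le_mul_of_nonneg_right h1 (by positivity)
      _ = poissonConst n / 2 * (‖x‖ ^ (n + 1))⁻¹ := by
          rw [show n + 3 = (n + 1) + 2 by ring, pow_add]
          field_simp
  have h4 := norm_sub_norm_le ((poissonConst n : ℂ) * -Complex.I * ((‖x‖ ^ (n + 1))⁻¹ : ℝ))
    (fio (fun _ _ => 1) (fun ξ => ‖ξ‖) f x)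
  rw [norm_sub_rev, hmain] at h4
  linarith

theorem lintegral_fio_norm_eq_top {n : ℕ} (hn : 1 ≤ n) (f : 𝓢(Rn n, ℂ))
    (hf : IsRadialBandLimited f) {p : ℝ} (hp : 0 < p) (hpn : p ≤ (n : ℝ) / (n + 1)) :
    ∫⁻ x : Rn n, ‖fio (fun _ _ => 1) (fun ξ => ‖ξ‖) f x‖ₑ ^ p = ⊤ := by
  obtain ⟨c, R, hc, hR, h⟩ := fio_norm_lower_bound hn f hf
  exact lintegral_rpow_eq_top_of_lower_bound hn hc hR hp hpn h

theorem eLpNorm_fio_norm_eq_top {n : ℕ} (hn : 1 ≤ n) (f : 𝓢(Rn n, ℂ))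
    (hf : IsRadialBandLimited f) {p : ℝ} (hp : 0 < p) (hpn : p ≤ (n : ℝ) / (n + 1)) :
    eLpNorm (fio (fun _ _ => 1) (fun ξ => ‖ξ‖) f) (ENNReal.ofReal p) volume = ⊤ := by
  rw [eLpNorm_eq_lintegral_rpow_enorm_toReal (by simpa using hp) ENNReal.ofReal_ne_top,
    ENNReal.toReal_ofReal hp.le, lintegral_fio_norm_eq_top hn f hf hp hpn,
    ENNReal.top_rpow_of_pos (by positivity)]

/-! ### Local Hardy norms of `f` and of `Tf`. -/

theorem LPCutoff.exists_profile {n : ℕ} (ψ : LPCutoff n) :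
    ∃ κ : 𝓢(Rn n, ℂ), hat (κ : Rn n → ℂ) = ψ.toFun :=
  exists_hat_eq ψ.toFun (HasCompactSupport.of_support_subset_isCompact (isCompact_closedBall 0 2)
    (ψ.support_subset.trans Metric.ball_subset_closedBall)) ψ.smooth

theorem integral_pos_smul {n : ℕ} (F : Rn n → ℂ) {t : ℝ} (ht : 0 < t) :
    ∫ w : Rn n, F (t • w) = ((t ^ n : ℝ) : ℂ)⁻¹ * ∫ z : Rn n, F z := by
  have h := Measure.integral_comp_smul (volume : Measure (Rn n)) F t
  rw [finrank_euclideanSpace_fin, abs_of_nonneg (by positivity), Complex.real_smul,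
    Complex.ofReal_inv] at h
  exact h

/-- The kernel of `ψ₀(tD)` is the `L¹`-normalised dilate of the profile. -/
theorem LPCutoff.kernel_eq_profile {n : ℕ} (ψ : LPCutoff n) {κ : 𝓢(Rn n, ℂ)}
    (hκ : hat (κ : Rn n → ℂ) = ψ.toFun) (t : Ioo (0 : ℝ) 1) (x y : Rn n) :
    ψ.kernel t x y = (((t : ℝ) ^ n : ℝ) : ℂ)⁻¹ * κ ((t : ℝ)⁻¹ • (x - y)) := by
  have ht : (0 : ℝ) < t := t.2.1
  rw [LPCutoff.kernel_apply, hat_inversion κ, hκ, mul_left_comm, ← integral_pos_smul _ ht]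
  congr 2
  ext ξ
  rw [inner_smul_left, inner_smul_right]
  simp only [conj_trivial]
  rw [inv_mul_cancel_left₀ ht.ne', mul_comm]

/-- Substituting `y = x - tw` moves `t` from the kernel into the argument of `h`, so estimates
against the fixed `κ` are uniform in `t`. -/
theorem LPCutoff.integral_kernel_mul {n : ℕ} (ψ : LPCutoff n) {κ : 𝓢(Rn n, ℂ)}
    (hκ : hat (κ : Rn n → ℂ) = ψ.toFun) (t : Ioo (0 : ℝ) 1) (x : Rn n) (h : Rn n → ℂ) :
    ∫ y : Rn n, ψ.kernel t x y * h y = ∫ w : Rn n, κ w * h (x - (t : ℝ) • w) := by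
  have ht : (0 : ℝ) < t := t.2.1
  have h1 := integral_pos_smul (fun z => κ ((t : ℝ)⁻¹ • z) * h (x - z)) ht
  simp only [inv_smul_smul₀ ht.ne'] at h1
  rw [h1, ← integral_sub_left_eq_self _ volume x, ← integral_const_mul]
  congr 1
  ext y
  rw [ψ.kernel_eq_profile hκ, sub_sub_cancel, mul_assoc]

theorem schwartz_decay_one_add_sq {n : ℕ} (f : 𝓢(Rn n, ℂ)) (N : ℕ) :
    ∃ C : ℝ, 0 ≤ C ∧ ∀ x, ‖f x‖ * (1 + ‖x‖ ^ 2) ^ N ≤ C := by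
  suffices h : ∃ C : ℝ, ∀ x, ‖f x‖ * (1 + ‖x‖ ^ 2) ^ N ≤ C by
    obtain ⟨C, hC⟩ := h
    exact ⟨C, (by positivity : 0 ≤ ‖f 0‖ * (1 + ‖(0 : Rn n)‖ ^ 2) ^ N).trans (hC 0), hC⟩
  refine ⟨2 ^ (2 * N) *
    ((Finset.Iic (2 * N, 0)).sup fun m => SchwartzMap.seminorm ℂ m.1 m.2) f, fun x => ?_⟩
  have h := SchwartzMap.one_add_le_sup_seminorm_apply (𝕜 := ℂ) (m := (2 * N, 0)) le_rfl le_rfl f x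
  rw [norm_iteratedFDeriv_zero, pow_mul, mul_comm] at h
  refine le_trans (mul_le_mul_of_nonneg_left ?_ (norm_nonneg _)) h
  exact pow_le_pow_left₀ (by positivity) (by nlinarith [norm_nonneg x]) N

/-- `ψ₀(tD)f` decays rapidly, uniformly in `0 < t < 1`, for Schwartz `f`. -/
theorem LPCutoff.op_schwartz_bound {n : ℕ} (ψ : LPCutoff n) (f : 𝓢(Rn n, ℂ)) (N : ℕ) :
    ∃ C : ℝ, 0 ≤ C ∧ ∀ (t : Ioo (0 : ℝ) 1) (x : Rn n),
      ‖ψ.op t (f : 𝓢'(Rn n, ℂ)) x‖ ≤ C * ((1 + ‖x‖ ^ 2) ^ N)⁻¹ := by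
  obtain ⟨κ, hκ⟩ := ψ.exists_profile
  obtain ⟨C, hC0, hC⟩ := schwartz_decay_one_add_sq f N
  have hI := schwartz_one_add_sq_integrable κ N
  set J := ∫ w : Rn n, ‖κ w‖ * (1 + ‖w‖ ^ 2) ^ N
  have hJ : 0 ≤ J := integral_nonneg fun y => by positivity
  refine ⟨J * (2 ^ N * C), by positivity, fun t x => ?_⟩
  have hop : ψ.op t (f : 𝓢'(Rn n, ℂ)) x = ∫ w : Rn n, κ w * f (x - (t : ℝ) • w) := by
    rw [LPCutoff.op, SchwartzMap.toTemperedDistributionCLM_apply_apply volume]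
    exact ψ.integral_kernel_mul hκ t x f
  rw [hop, mul_assoc, ← integral_mul_const]
  refine norm_integral_le_of_norm_le (hI.mul_const _) (Eventually.of_forall fun w => ?_)
  rw [norm_mul, mul_assoc]
  refine mul_le_mul_of_nonneg_left ?_ (norm_nonneg _)
  -- Peetre's inequality; `t < 1` makes it uniform in `t`.
  have hx : (1 + ‖x‖ ^ 2) ≤ 2 * (1 + ‖x - (t : ℝ) • w‖ ^ 2) * (1 + ‖w‖ ^ 2) := by
    have h1 : ‖x‖ ≤ ‖x - (t : ℝ) • w‖ + ‖w‖ := by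
      have h2 := norm_add_le (x - (t : ℝ) • w) ((t : ℝ) • w)
      rw [sub_add_cancel, norm_smul, Real.norm_of_nonneg t.2.1.le] at h2
      have h3 := mul_le_of_le_one_left (norm_nonneg w) t.2.2.le
      linarith
    have h4 : ‖x‖ ^ 2 ≤ (‖x - (t : ℝ) • w‖ + ‖w‖) ^ 2 := pow_le_pow_left₀ (norm_nonneg _) h1 2
    nlinarith [sq_nonneg (‖x - (t : ℝ) • w‖ - ‖w‖), sq_nonneg (‖x - (t : ℝ) • w‖ * ‖w‖)]
  have hxN := pow_le_pow_left₀ (by positivity) hx N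
  rw [mul_pow, mul_pow] at hxN
  have hf := hC (x - (t : ℝ) • w)
  rw [← mul_assoc, ← div_eq_mul_inv, le_div_iff₀ (by positivity)]
  calc ‖f (x - (t : ℝ) • w)‖ * (1 + ‖x‖ ^ 2) ^ N
      ≤ ‖f (x - (t : ℝ) • w)‖ *
        (2 ^ N * (1 + ‖x - (t : ℝ) • w‖ ^ 2) ^ N * (1 + ‖w‖ ^ 2) ^ N) :=
        mul_le_mul_of_nonneg_left hxN (norm_nonneg _)
    _ = (1 + ‖w‖ ^ 2) ^ N * (2 ^ N *
        (‖f (x - (t : ℝ) • w)‖ * (1 + ‖x - (t : ℝ) • w‖ ^ 2) ^ N)) := by ring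
    _ ≤ (1 + ‖w‖ ^ 2) ^ N * (2 ^ N * C) := by gcongr

/-- Schwartz functions belong to every local Hardy space. -/
theorem hpNorm_schwartz_lt_top {n : ℕ} (ψ : LPCutoff n) {p : ℝ} (hp : 0 < p) (f : 𝓢(Rn n, ℂ)) :
    hpNorm ψ p (f : 𝓢'(Rn n, ℂ)) < ⊤ := by
  -- `2Np > n` makes the `p`-th power of the decay bound integrable.
  obtain ⟨N, hN⟩ := exists_nat_gt ((n : ℝ) / (2 * p))
  rw [div_lt_iff₀ (by positivity)] at hN
  obtain ⟨C, hC0, hC⟩ := ψ.op_schwartz_bound f N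
  refine ENNReal.rpow_lt_top_of_nonneg (by positivity) (ne_of_lt ?_)
  have hint : Integrable fun x : Rn n => C ^ p * (1 + ‖x‖ ^ 2) ^ (-(2 * N * p) / 2) :=
    (integrable_rpow_neg_one_add_norm_sq (by rw [finrank_euclideanSpace_fin]; linarith)).const_mul _
  refine (lintegral_mono fun x => ?_).trans_lt hint.hasFiniteIntegral
  refine iSup_le fun t => ?_
  rw [← ofReal_norm, ← ofReal_norm,
    ENNReal.ofReal_rpow_of_nonneg (norm_nonneg _) hp.le]
  refine ENNReal.ofReal_le_ofReal ?_
  rw [Real.norm_of_nonneg (by positivity)]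
  refine (Real.rpow_le_rpow (norm_nonneg _) (hC t x) hp.le).trans_eq ?_
  rw [Real.mul_rpow hC0 (by positivity)]
  congr 1
  rw [Real.inv_rpow (by positivity), ← Real.rpow_natCast _ N, ← Real.rpow_mul (by positivity),
    ← Real.rpow_neg (by positivity)]
  congr 1
  ring

theorem LPCutoff.op_fioDist {n : ℕ} (ψ : LPCutoff n) {κ : 𝓢(Rn n, ℂ)}
    (hκ : hat (κ : Rn n → ℂ) = ψ.toFun) {m : ℝ} {σ : Rn n → Rn n → ℂ} {φ : Rn n → ℝ}
    (hσ : IsAmplitude m σ) (hφ : IsPhase φ) (f : 𝓢(Rn n, ℂ)) (t : Ioo (0 : ℝ) 1) (x : Rn n) :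
    ψ.op t (fioDist hσ hφ f) x = ∫ w : Rn n, κ w * fio σ φ f (x - (t : ℝ) • w) := by
  rw [LPCutoff.op, fioDist, Lp.toTemperedDistribution_apply, ← ψ.integral_kernel_mul hκ]
  refine integral_congr_ae ?_
  filter_upwards [(fio_memLp_top hσ hφ f).coeFn_toLp] with y hy
  rw [hy, smul_eq_mul]

/-- `ψ₀(tD)` acts on `T f` through the multiplier `ψ₀(tξ)`. -/
theorem LPCutoff.op_fioDist_one {n : ℕ} (ψ : LPCutoff n) (f : 𝓢(Rn n, ℂ)) (t : Ioo (0 : ℝ) 1)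
    (x : Rn n) :
    ψ.op t (fioDist (isAmplitude_one n) (isPhase_norm n) f) x =
      (((2 * Real.pi) ^ n : ℝ) : ℂ)⁻¹ * ∫ ξ : Rn n, ψ.toFun ((t : ℝ) • ξ) *
        (Complex.exp (Complex.I * ((inner ℝ x ξ + ‖ξ‖ : ℝ) : ℂ)) * hat f ξ) := by
  obtain ⟨κ, hκ⟩ := ψ.exists_profile
  rw [ψ.op_fioDist hκ]
  set F : Rn n → Rn n → ℂ := fun w ξ => κ w * hat f ξ *
    Complex.exp (Complex.I * ((inner ℝ (x - (t : ℝ) • w) ξ + ‖ξ‖ : ℝ) : ℂ)) with hF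
  have hint : Integrable (Function.uncurry F) (volume.prod volume) := by
    refine (κ.integrable.mul_prod (hat_integrable' f)).mul_bdd (c := 1)
      (Continuous.aestronglyMeasurable (by fun_prop)) (Eventually.of_forall fun z =>
        (norm_exp_I_mul _).le)
  have hswap := integral_integral_swap hint
  have hleft : ∀ w : Rn n, ∫ ξ : Rn n, F w ξ = (((2 * Real.pi) ^ n : ℝ) : ℂ) *
      (κ w * fio (fun _ _ => 1) (fun ξ => ‖ξ‖) f (x - (t : ℝ) • w)) := by
    intro w
    have h2 : (((2 * Real.pi) ^ n : ℝ) : ℂ) ≠ 0 := by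
      exact_mod_cast (by positivity : ((2 * Real.pi) ^ n : ℝ) ≠ 0)
    rw [fio, mul_left_comm (κ w), mul_inv_cancel_left₀ h2, ← integral_const_mul]
    congr 1
    ext ξ
    simp only [hF]
    ring
  have hright : ∀ ξ : Rn n, ∫ w : Rn n, F w ξ = ψ.toFun ((t : ℝ) • ξ) *
        (Complex.exp (Complex.I * ((inner ℝ x ξ + ‖ξ‖ : ℝ) : ℂ)) * hat f ξ) := by
    intro ξ
    rw [← hκ, hat, ← integral_mul_const]
    congr 1
    ext w
    simp only [hF]
    rw [inner_sub_left, inner_smul_left, inner_smul_right, conj_trivial,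
      show (Complex.I * ((inner ℝ x ξ - (t : ℝ) * inner ℝ w ξ + ‖ξ‖ : ℝ) : ℂ)) =
        -(Complex.I * (((t : ℝ) * inner ℝ w ξ : ℝ) : ℂ)) +
        Complex.I * ((inner ℝ x ξ + ‖ξ‖ : ℝ) : ℂ) by push_cast; ring, Complex.exp_add]
    ring
  simp only [hleft, hright] at hswap
  rw [integral_const_mul] at hswap
  have h2 : (((2 * Real.pi) ^ n : ℝ) : ℂ) ≠ 0 := by
    exact_mod_cast (by positivity : ((2 * Real.pi) ^ n : ℝ) ≠ 0)
  rw [← hswap, inv_mul_cancel_left₀ h2]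

/-- For band-limited `f` and small `t` the operator `ψ₀(tD)` fixes `T f`. -/
theorem LPCutoff.exists_op_fioDist_eq {n : ℕ} (ψ : LPCutoff n) (f : 𝓢(Rn n, ℂ))
    (hc : HasCompactSupport (hat f)) :
    ∃ t : Ioo (0 : ℝ) 1, ∀ x, ψ.op t (fioDist (isAmplitude_one n) (isPhase_norm n) f) x =
      fio (fun _ _ => 1) (fun ξ => ‖ξ‖) f x := by
  obtain ⟨r, hr0, hr⟩ := hc.isBounded.exists_pos_norm_lt
  have hr1 : 0 < r + 1 := by linarith
  -- With `|ξ| < r` wherever `f̂(ξ) ≠ 0`, this `t` puts `tξ` in the unit ball, where `ψ₀ = 1`.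
  refine ⟨⟨(r + 1)⁻¹, inv_pos.2 hr1, inv_lt_one_of_one_lt₀ (by linarith)⟩, fun x => ?_⟩
  rw [ψ.op_fioDist_one, fio]
  congr 2
  ext ξ
  by_cases hξ : hat f ξ = 0
  · simp [hξ]
  · have h1 : ‖ξ‖ < r := hr ξ (subset_tsupport _ hξ)
    rw [ψ.eq_one, one_mul, one_mul]
    rw [mem_ball_zero_iff, norm_smul, Real.norm_of_nonneg (inv_pos.2 hr1).le, inv_mul_lt_iff₀ hr1]
    linarith

/-- The maximal function dominates `|Tf|`, through the single `t` at which `ψ₀(tD)` fixes `Tf`. -/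
theorem hpNorm_fioDist_eq_top {n : ℕ} (hn : 1 ≤ n) (f : 𝓢(Rn n, ℂ)) (hf : IsRadialBandLimited f)
    {p : ℝ} (hp : 0 < p) (hpn : p ≤ (n : ℝ) / (n + 1)) (ψ : LPCutoff n) :
    hpNorm ψ p (fioDist (isAmplitude_one n) (isPhase_norm n) f) = ⊤ := by
  obtain ⟨t, ht⟩ := ψ.exists_op_fioDist_eq f hf.hat_compact
  rw [hpNorm, ENNReal.rpow_eq_top_iff_of_pos (by positivity), eq_top_iff,
    ← lintegral_fio_norm_eq_top hn f hf hp hpn]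
  refine lintegral_mono fun x => ?_
  rw [← ht x]
  exact le_iSup (fun t : Ioo (0 : ℝ) 1 =>
    ‖ψ.op t (fioDist (isAmplitude_one n) (isPhase_norm n) f) x‖ₑ ^ p) t

/-! ### An amplitude of order `-∞` without `h^p` bounds. -/

/-- A smooth compactly supported function of `ξ` is an amplitude of every order. -/
theorem isAmplitude_of_hasCompactSupport {n : ℕ} {g : Rn n → ℂ} (hc : HasCompactSupport g)
    (hs : ContDiff ℝ ∞ g) (m : ℝ) : IsAmplitude m fun _ ξ => g ξ where
  smooth := hs.comp contDiff_snd
  bound := by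
    intro k l
    rcases Nat.eq_zero_or_pos l with rfl | hl
    · have hcont : Continuous fun ξ : Rn n =>
          iteratedFDeriv ℝ k g ξ := hs.continuous_iteratedFDeriv (by exact_mod_cast le_top)
      have hw : Continuous fun ξ : Rn n => ((1 + ‖ξ‖ ^ 2) ^ ((m - k) / 2))⁻¹ := by
        refine Continuous.inv₀ (Continuous.rpow_const (by fun_prop) fun ξ => Or.inl ?_) fun ξ => ?_
        all_goals positivity
      -- Dividing the derivative by the weight leaves a continuous function of compact support,
      -- hence a bounded one, for any `m`.
      obtain ⟨C, hC⟩ := Continuous.bounded_above_of_compact_support (hw.smul hcont)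
        (HasCompactSupport.smul_left (hc.iteratedFDeriv k))
      refine ⟨C, fun x ξ => ?_⟩
      have h := hC ξ
      simp only [Pi.smul_apply'] at h
      rw [norm_smul, Real.norm_of_nonneg (by positivity), inv_mul_le_iff₀ (by positivity),
        mul_comm] at h
      refine le_trans (le_of_eq ?_) h
      exact (continuousMultilinearCurryFin0 ℝ (Rn n) ℂ).symm.norm_iteratedFDeriv_comp_left g ξ k
    · refine ⟨0, fun x ξ => ?_⟩
      simp only [iteratedFDeriv_const_of_ne (𝕜 := ℝ) (E := Rn n) hl.ne', Pi.zero_apply, zero_mul]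
      rw [show (fun _ : Rn n => (0 : (Rn n) [×l]→L[ℝ] ℂ)) = 0 from rfl]
      simp

theorem fioDist_congr {n : ℕ} {m m' : ℝ} {σ σ' : Rn n → Rn n → ℂ} {φ : Rn n → ℝ}
    (hσ : IsAmplitude m σ) (hσ' : IsAmplitude m' σ') (hφ : IsPhase φ) {f f' : 𝓢(Rn n, ℂ)}
    (h : fio σ φ f = fio σ' φ f') : fioDist hσ hφ f = fioDist hσ' hφ f' := by
  unfold fioDist
  congr 1
  exact MemLp.toLp_congr _ _ (Eventually.of_forall fun x => congrFun h x)

/-- The order `-∞` amplitude `f̂₀` gives an operator mapping `f₀` outside `h^p`. -/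
theorem exists_unbounded_amplitude {n : ℕ} (hn : 1 ≤ n) :
    ∃ σ : Rn n → Rn n → ℂ, ∀ m : ℝ, ∃ hσ : IsAmplitude m σ,
      ∀ p : ℝ, 0 < p → p ≤ (n : ℝ) / (n + 1) → ∀ ψ : LPCutoff n,
        ¬ ∃ C : ℝ≥0, ∀ f : 𝓢(Rn n, ℂ),
          hpNorm ψ p (fioDist hσ (isPhase_norm n) f) ≤ C * hpNorm ψ p (f : 𝓢'(Rn n, ℂ)) := by
  obtain ⟨f, hf⟩ := exists_radial_bump n
  -- With `σ = f̂` one has `T_σ f = Tg` for `ĝ = f̂²`, so testing on this one `f` already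
  -- contradicts every finite `C`.
  obtain ⟨g, hg, hgf⟩ := exists_isRadialBandLimited (fun ξ => hat f ξ * hat f ξ)
    hf.hat_compact.mul_left ((hat_contDiff f).mul (hat_contDiff f))
    (fun ξ η h => by rw [hat_radial hf.radial ξ η h])
    (hf.hat_eq_one.mono fun ξ h => by rw [h, one_mul])
  refine ⟨fun _ ξ => hat f ξ, fun m =>
    ⟨isAmplitude_of_hasCompactSupport hf.hat_compact (hat_contDiff f) m, ?_⟩⟩
  rintro p hp hpn ψ ⟨C, hC⟩
  have h := hC f
  rw [fioDist_congr _ (isAmplitude_one n) (isPhase_norm n) (f' := g) ?_,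
    hpNorm_fioDist_eq_top hn g hg hp hpn ψ, top_le_iff] at h
  · exact (ENNReal.mul_lt_top ENNReal.coe_lt_top (hpNorm_schwartz_lt_top ψ hp f)).ne h
  · ext x
    rw [fio, fio, hgf]
    congr 2
    ext ξ
    ring

end GlobalFIO

open GlobalFIO
theorem mainTheorem3 (n : ℕ) (hn : 1 ≤ n) :
    (∃ f : 𝓢(Rn n, ℂ), IsRadialBandLimited f) ∧
    (∀ f : 𝓢(Rn n, ℂ), IsRadialBandLimited f →
      (fun x : Rn n =>
          fio (fun _ _ => 1) (fun ξ => ‖ξ‖) f x -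
            (Real.Gamma (((n : ℝ) + 1) / 2) : ℂ) * hat f 0 /
              (((Real.pi ^ (((n : ℝ) + 1) / 2) : ℝ) : ℂ) * Complex.I) *
                ((‖x‖ ^ (n + 1))⁻¹ : ℝ))
        =O[Bornology.cobounded (Rn n)]
          (fun x : Rn n => (1 + Real.log ‖x‖) / ‖x‖ ^ (n + 3))) ∧
    (∀ f : 𝓢(Rn n, ℂ), IsRadialBandLimited f →
      ∀ p : ℝ, 0 < p → p ≤ (n : ℝ) / (n + 1) →
        eLpNorm (fio (fun _ _ => 1) (fun ξ => ‖ξ‖) f) (ENNReal.ofReal p) volume = ⊤ ∧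
        ∀ ψ : LPCutoff n,
          hpNorm ψ p (f : 𝓢'(Rn n, ℂ)) < ⊤ ∧
          hpNorm ψ p (fioDist (isAmplitude_one n) (isPhase_norm n) f) = ⊤) ∧
    (∃ σ : Rn n → Rn n → ℂ, ∀ m : ℝ, ∃ hσ : IsAmplitude m σ,
      ∀ p : ℝ, 0 < p → p ≤ (n : ℝ) / (n + 1) → ∀ ψ : LPCutoff n,
        ¬ ∃ C : ℝ≥0, ∀ f : 𝓢(Rn n, ℂ),
          hpNorm ψ p (fioDist hσ (isPhase_norm n) f) ≤ C * hpNorm ψ p (f : 𝓢'(Rn n, ℂ))) := by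
  exact ⟨exists_radial_bump n, fio_norm_isBigO hn, fun f hf p hp hpn =>
    ⟨eLpNorm_fio_norm_eq_top hn f hf hp hpn, fun ψ =>
      ⟨hpNorm_schwartz_lt_top ψ hp f, hpNorm_fioDist_eq_top hn f hf hp hpn ψ⟩⟩,
    exists_unbounded_amplitude hn⟩
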